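/- Let $A=(\mathbf a_0,\dots,\mathbf a_n)$ be an integer $d\times(n+1)$ matrix whose columns generate $\mathbb Z^d$ as a group, and put $A'=(\mathbf a_1,\dots,\mathbf a_n)$; let $\beta\in\mathbb C^d$. *Hypergeometric system and $b$-function.* Let $D$ be the ring of algebraic $\mathbb C$-linear differential operators on $\mathbb C^{n+1}$ with coordinates $x_0,\dots,x_n$ and $\partial_j=\partial/\partial x_j$. Let $H_A(\beta)\subseteq D$ be the left ideal generated by the operators $\sum_j a_{i,j}x_j\partial_j-\beta_i$ ($1\le i\le d$) and $\partial^{\mathbf v_+}-\partial^{\mathbf v_-}$ for all $\mathbf v\in\mathbb Z^{n+1}$ with $A\mathbf v=0$, where $(\mathbf v_\pm)_j=\max(0,\pm v_j)$, and let $M_A(\beta)=D/H_A(\beta)$. Let $V^1D$ be the $\mathbb C$-span of the monomials $x^{\mathbf u}\partial^{\mathbf w}$ with $u_0-w_0\ge 1$. The $b$-function of $M_A(\beta)$ along $x_0=0$ is the monic polynomial $b(s)\in\mathbb C[s]$ of minimal degree such that $b(x_0\partial_0)\in H_A(\beta)+V^1D$. *Toric rings and quasi-degrees.* For $B=A$ or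 $B=A'$ let $R_B$ be the polynomial ring over $\mathbb C$ in the variables $\partial_j$ attached to the columns of $B$, graded by $\deg\partial_j=\mathbf a_j$; let $I_B\subseteq R_B$ be the ideal generated by all $\partial^{\mathbf v_+}-\partial^{\mathbf v_-}$ with $\mathbf v$ integral and $B\mathbf v=0$, and $S_B=R_B/I_B$. Regard $S_{A'}$ as a subring of $S_A$. For a $\mathbb Z^d$-graded vector space $N$ let $\operatorname{qdeg}(N)$ be the Zariski closure in $\mathbb C^d$ of $\{\alpha\in\mathbb Z^d: N_\alpha\ne0\}$. For $i\in\mathbb N$ let $\bar J_{A,0;i}\subseteq S_{A'}$ be the ideal which is the $\mathbb C$-span of the monomials $\partial^{\mathbf u}$ of $S_{A'}$ with $\partial_0^i\partial^{\mathbf u}\in S_{A'}$, and let $J_{A,0;i}\subseteq R_{A'}$ be its preimage. Put $J_{A,0}=\sum_{i\ge1}J_{A,0;i}$ and let $\bar J_{A,0}$ be its image in $S_{A'}$. **Theorem.** The $b$-function $b(s)$ of $M_A(\beta)$ along $x_0=0$ exists and is unique, there is $k\in\mathbb N$ with $J_{A,0}=\sum_{1\le i\le k}J_{A,0;i}$,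 and the following hold. 1. For every $k\in\mathbb N$ such that $J_{A,0}=\sum_{1\le i\le k}J_{A,0;i}$, every root $\varepsilon$ of $b$ lies in $\{0,1,\dots,k-1\}$ or satisfies $$\varepsilon\,\mathbf a_0\in\bigl(-\operatorname{qdeg}(S_{A'}/\bar J_{A,0})+\beta\bigr)\cap\mathbb C\,\mathbf a_0 .$$ 2. If $\dim S_{A'}=\dim S_A-1$ (Krull dimensions), then there is $\varepsilon\in\mathbb C$ with $b(s)=s-\varepsilon$ and $$\bigl(-\operatorname{qdeg}(S_{A'})+\beta\bigr)\cap\mathbb C\,\mathbf a_0=\{\varepsilon\,\mathbf a_0\}.$$ 3. If $\mathbf a_0\in\mathbb R_{\ge0}A'$, then there is a least positive integer $k$ with $k\,\mathbf a_0\in\mathbb N A'$, and every root of $b$ lies in $\{0,1,\dots,k-1\}$. -/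

import Mathlib

open MvPolynomial
open scoped Matrix

noncomputable section

/-! ### The Weyl algebra and the `V`-filtration -/

/-- The free algebra on symbols `x_j` (`Sum.inl j`) and `∂_j` (`Sum.inr j`), `j : Fin m`. -/
abbrev WeylFree (m : ℕ) : Type := FreeAlgebra ℂ (Fin m ⊕ Fin m)

/-- The defining relations of the ring of differential operators on `ℂ^m`. -/
inductive WeylRel (m : ℕ) : WeylFree m → WeylFree m → Prop
  | x_comm (i j : Fin m) :
      WeylRel m (FreeAlgebra.ι ℂ (Sum.inl i) * FreeAlgebra.ι ℂ (Sum.inl j))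
        (FreeAlgebra.ι ℂ (Sum.inl j) * FreeAlgebra.ι ℂ (Sum.inl i))
  | del_comm (i j : Fin m) :
      WeylRel m (FreeAlgebra.ι ℂ (Sum.inr i) * FreeAlgebra.ι ℂ (Sum.inr j))
        (FreeAlgebra.ι ℂ (Sum.inr j) * FreeAlgebra.ι ℂ (Sum.inr i))
  | del_x (i j : Fin m) :
      WeylRel m (FreeAlgebra.ι ℂ (Sum.inr i) * FreeAlgebra.ι ℂ (Sum.inl j))
        (FreeAlgebra.ι ℂ (Sum.inl j) * FreeAlgebra.ι ℂ (Sum.inr i) + if i = j then 1 else 0)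

/-- The Weyl algebra: the ring of algebraic `ℂ`-linear differential operators on `ℂ^m`,
presented by the generators `x_j, ∂_j` and the relations `[x_i, x_j] = 0`, `[∂_i, ∂_j] = 0`,
`[∂_i, x_j] = δ_{ij}`. -/
abbrev Weyl (m : ℕ) : Type := RingQuot (WeylRel m)

namespace Weyl

variable {m : ℕ}

/-- Multiplication by the coordinate `x_j`. -/
def x (j : Fin m) : Weyl m := RingQuot.mkAlgHom ℂ (WeylRel m) (FreeAlgebra.ι ℂ (Sum.inl j))

/-- The partial derivative `∂_j`. -/
def del (j : Fin m) : Weyl m := RingQuot.mkAlgHom ℂ (WeylRel m) (FreeAlgebra.ι ℂ (Sum.inr j))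

/-- `x^u = x_0^{u_0} x_1^{u_1} ⋯`. -/
def xPow (u : Fin m → ℕ) : Weyl m := (List.ofFn fun j => x j ^ u j).prod

/-- `∂^u = ∂_0^{u_0} ∂_1^{u_1} ⋯`. -/
def delPow (u : Fin m → ℕ) : Weyl m := (List.ofFn fun j => del j ^ u j).prod

/-- The level `i` of the `V`-filtration along `x_t = 0`: the span of all monomials `x^α ∂^γ` with
`α_t - γ_t ≥ i`. -/
def V (t : Fin m) (i : ℤ) : Submodule ℂ (Weyl m) :=
  Submodule.span ℂ
    {P | ∃ α γ : Fin m → ℕ, i ≤ (α t : ℤ) - (γ t : ℤ) ∧ P = xPow α * delPow γ}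

end Weyl

/-- `BFunctionEquation t e b` says that `b(x_t ∂_t) · e ∈ (V^1 D) · e`. -/
def BFunctionEquation {m : ℕ} (t : Fin m) {M : Type*} [AddCommGroup M] [Module (Weyl m) M]
    (e : M) (b : Polynomial ℂ) : Prop :=
  ∃ Q ∈ Weyl.V t 1, Polynomial.aeval (Weyl.x t * Weyl.del t) b • e = Q • e

/-- `b` is the `b`-function of the element `e` of the left module `M` along `x_t = 0`: the monic
polynomial of minimal degree with `b(x_t ∂_t) · e ∈ (V^1 D) · e`. -/
def IsBFunction {m : ℕ} (t : Fin m) {M : Type*} [AddCommGroup M] [Module (Weyl m) M]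
    (e : M) (b : Polynomial ℂ) : Prop :=
  b.Monic ∧ BFunctionEquation t e b ∧
    ∀ q : Polynomial ℂ, q.Monic → BFunctionEquation t e q → b.natDegree ≤ q.natDegree

/-! ### The hypergeometric system -/

namespace GKZ

variable {d m n : ℕ}

/-- `v_+`, with entries `max(0, v_j)`. -/
def posPart (v : Fin m → ℤ) : Fin m → ℕ := fun j => (v j).toNat

/-- `v_-`, with entries `max(0, -v_j)`. -/
def negPart (v : Fin m → ℤ) : Fin m → ℕ := fun j => (-v j).toNat

/-- The Euler operator `E_i = ∑_j a_{i,j} x_j ∂_j`. -/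
def euler (A : Matrix (Fin d) (Fin m) ℤ) (i : Fin d) : Weyl m :=
  ∑ j, (A i j : ℂ) • (Weyl.x j * Weyl.del j)

/-- The hypergeometric left ideal `H_A(β)`. -/
def hypergeometricIdeal (A : Matrix (Fin d) (Fin m) ℤ) (β : Fin d → ℂ) :
    Submodule (Weyl m) (Weyl m) :=
  Submodule.span (Weyl m)
    ({P | ∃ i, P = euler A i - algebraMap ℂ (Weyl m) (β i)} ∪
      {P | ∃ v : Fin m → ℤ, A *ᵥ v = 0 ∧
        P = Weyl.delPow (posPart v) - Weyl.delPow (negPart v)})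

/-- The hypergeometric system `M_A(β) = D / H_A(β)`. -/
abbrev hypergeometricModule (A : Matrix (Fin d) (Fin m) ℤ) (β : Fin d → ℂ) : Type :=
  Weyl m ⧸ hypergeometricIdeal A β

/-- The `b`-function of the cyclic module `M_A(β)` along `x_t = 0` is that of the coset of `1`. -/
def IsHypergeometricBFunction (A : Matrix (Fin d) (Fin m) ℤ) (β : Fin d → ℂ) (t : Fin m)
    (b : Polynomial ℂ) : Prop :=
  IsBFunction t ((hypergeometricIdeal A β).mkQ 1) b

/-! ### Toric rings -/

/-- The polynomial ring `R_A`; the variable `X j` stands for `∂_j`. -/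
abbrev R (m : ℕ) : Type := MvPolynomial (Fin m) ℂ

/-- The monomial `∂^u` in `R_A`. -/
def mono (u : Fin m → ℕ) : R m := ∏ j, X j ^ u j

/-- The toric ideal `I_A`. -/
def toricIdeal (A : Matrix (Fin d) (Fin m) ℤ) : Ideal (R m) :=
  Ideal.span {p | ∃ v : Fin m → ℤ, A *ᵥ v = 0 ∧ p = mono (posPart v) - mono (negPart v)}

/-- The toric ring `S_A = R_A / I_A`. -/
abbrev S (A : Matrix (Fin d) (Fin m) ℤ) : Type := R m ⧸ toricIdeal A

/-- The matrix `A' = (a_1, …, a_n)` obtained from `A = (a_0, …, a_n)`. -/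
def dropFirst (A : Matrix (Fin d) (Fin (n + 1)) ℤ) : Matrix (Fin d) (Fin n) ℤ :=
  A.submatrix id Fin.succ

/-- The inclusion of polynomial rings `R_{A'} → R_A`. -/
def polyInclusion (n : ℕ) : R n →ₐ[ℂ] R (n + 1) := rename Fin.succ

theorem toricIdeal_dropFirst_le (A : Matrix (Fin d) (Fin (n + 1)) ℤ) :
    toricIdeal (dropFirst A) ≤ (toricIdeal A).comap (polyInclusion n) := by
  refine Ideal.span_le.2 ?_
  rintro _ ⟨v, hv, rfl⟩
  refine Ideal.subset_span ⟨Fin.cons 0 v, ?_, ?_⟩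
  · ext i
    have h := congrFun hv i
    simp only [Matrix.mulVec, dotProduct, dropFirst, Matrix.submatrix_apply, id,
      Pi.zero_apply] at h ⊢
    rw [Fin.sum_univ_succ]
    simpa using h
  · simp [polyInclusion, mono, posPart, negPart, Fin.prod_univ_succ]

/-- The ring map `S_{A'} → S_A`, through which `S_{A'}` is regarded as a subring of `S_A`. -/
def toricInclusion (A : Matrix (Fin d) (Fin (n + 1)) ℤ) : S (dropFirst A) →+* S A :=
  Ideal.quotientMap (toricIdeal A) (polyInclusion n : R n →+* R (n + 1))
    (toricIdeal_dropFirst_le A)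

/-- The monomials `∂^u` of `S_{A'}` with `∂_0^k ∂^u ∈ S_{A'}`, as elements of `S_{A'}`. -/
def jMonomials (A : Matrix (Fin d) (Fin (n + 1)) ℤ) (k : ℕ) : Set (S (dropFirst A)) :=
  {p | ∃ u : Fin n → ℕ, p = Ideal.Quotient.mk _ (mono u) ∧
    Ideal.Quotient.mk (toricIdeal A) (X 0) ^ k * toricInclusion A p ∈ (toricInclusion A).range}

theorem mono_mul_mem_span (A : Matrix (Fin d) (Fin (n + 1)) ℤ) (k : ℕ) (w : Fin n → ℕ)
    {p : S (dropFirst A)} (hp : p ∈ Submodule.span ℂ (jMonomials A k)) :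
    Ideal.Quotient.mk _ (mono w) * p ∈ Submodule.span ℂ (jMonomials A k) := by
  induction hp using Submodule.span_induction with
  | mem p hp =>
    obtain ⟨u, rfl, q, hq⟩ := hp
    refine Submodule.subset_span ⟨w + u, ?_, ?_⟩
    · rw [← map_mul]
      simp [mono, pow_add, Finset.prod_mul_distrib]
    · refine ⟨Ideal.Quotient.mk _ (mono w) * q, ?_⟩
      rw [map_mul, hq, map_mul]
      ring
  | zero => simp
  | add p q _ _ hp hq => rw [mul_add]; exact add_mem hp hq
  | smul c p _ hp => rw [mul_smul_comm]; exact Submodule.smul_mem _ c hp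

/-- The ideal `J̄_{A,0;k}` of `S_{A'}`: the vector space spanned by the monomials `∂^u` of `S_{A'}`
with `∂_0^k ∂^u ∈ S_{A'}`. -/
def barJLevel (A : Matrix (Fin d) (Fin (n + 1)) ℤ) (k : ℕ) : Ideal (S (dropFirst A)) where
  carrier := Submodule.span ℂ (jMonomials A k)
  add_mem' := add_mem
  zero_mem' := zero_mem _
  smul_mem' := by
    intro c p hp
    obtain ⟨c, rfl⟩ := Ideal.Quotient.mk_surjective c
    rw [smul_eq_mul]
    induction c using MvPolynomial.induction_on'' generalizing p with
    | C a =>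
      have : Ideal.Quotient.mk (toricIdeal (dropFirst A)) (C a) * p = a • p := by
        obtain ⟨q, rfl⟩ := Ideal.Quotient.mk_surjective p
        rw [← map_mul, C_mul']
        rfl
      rw [this]
      exact Submodule.smul_mem _ a hp
    | monomial_add u a f _ _ h₁ h₂ =>
      rw [map_add, add_mul]
      exact add_mem (h₂ hp) (h₁ hp)
    | mul_X f j h =>
      rw [map_mul, mul_assoc]
      refine h ?_
      have : (X j : R n) = mono (Pi.single j 1) := by
        rw [mono, Finset.prod_eq_single j] <;> simp +contextual
      rw [this]
      exact mono_mul_mem_span A k _ hp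

/-- `J_{A,0;k} ⊆ R_{A'}`, the preimage of `J̄_{A,0;k}`. -/
def jLevel (A : Matrix (Fin d) (Fin (n + 1)) ℤ) (k : ℕ) : Ideal (R n) :=
  (barJLevel A k).comap (Ideal.Quotient.mk (toricIdeal (dropFirst A)))

/-- `J_{A,0} = ∑_{k ≥ 1} J_{A,0;k}`. -/
def jIdeal (A : Matrix (Fin d) (Fin (n + 1)) ℤ) : Ideal (R n) :=
  ⨆ k ∈ Set.Ici 1, jLevel A k

/-- `J̄_{A,0} = J_{A,0} / I_{A'} ⊆ S_{A'}`. -/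
def barJ (A : Matrix (Fin d) (Fin (n + 1)) ℤ) : Ideal (S (dropFirst A)) :=
  (jIdeal A).map (Ideal.Quotient.mk (toricIdeal (dropFirst A)))

/-! ### Degrees and quasi-degrees -/

/-- The graded piece of degree `α` of `S_A`, where `deg ∂_j = a_j`. -/
def toricPiece (A : Matrix (Fin d) (Fin m) ℤ) (α : Fin d → ℤ) : Submodule ℂ (S A) :=
  (weightedHomogeneousSubmodule ℂ A.col α).map (Ideal.Quotient.mkₐ ℂ (toricIdeal A)).toLinearMap

/-- The graded piece of degree `α` of `S_A / J`, for an `A`-graded ideal `J` of `S_A`. -/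
def quotientPiece (A : Matrix (Fin d) (Fin m) ℤ) (J : Ideal (S A)) (α : Fin d → ℤ) :
    Submodule ℂ (S A ⧸ J) :=
  (toricPiece A α).map (Ideal.Quotient.mkₐ ℂ J).toLinearMap

/-- The set of degrees of the nonzero homogeneous elements of a graded vector space. -/
def degrees {N : Type*} [AddCommGroup N] [Module ℂ N] (𝒩 : (Fin d → ℤ) → Submodule ℂ N) :
    Set (Fin d → ℤ) :=
  {α | 𝒩 α ≠ ⊥}

/-- The image of an integer vector in `ℂ^d`. -/
def toComplex (α : Fin d → ℤ) : Fin d → ℂ := fun i => (α i : ℂ)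

/-- The quasi-degrees: the Zariski closure in `ℂ^d` of the set of degrees. -/
def quasiDegrees {N : Type*} [AddCommGroup N] [Module ℂ N] (𝒩 : (Fin d → ℤ) → Submodule ℂ N) :
    Set (Fin d → ℂ) :=
  zeroLocus ℂ (vanishingIdeal ℂ (toComplex '' degrees 𝒩))

/-- For `Q ⊆ ℂ^d`, the set `(-Q + β) ∩ ℂ · a`. -/
def lineIntersection (Q : Set (Fin d → ℂ)) (β a : Fin d → ℂ) : Set (Fin d → ℂ) :=
  {z | ∃ q ∈ Q, z = -q + β} ∩ {z | ∃ c : ℂ, z = c • a}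

end GKZ

end

/-!
Write `W = H_A(β) + V^1 D` and `θ_0 = x_0 ∂_0`. Since `W` is stable under left multiplication by
`θ_0`, the polynomials `b` with `b(θ_0) ∈ W` form an ideal of `ℂ[s]` (`GKZ.bIdeal`). Once this ideal
is nonzero, its monic generator is the unique `b`-function and divides each of its elements, so that
bounds on the roots come from exhibiting elements.

*The general bound.* If `∂_0^i r = r'` in `S_A` with `r, r' ∈ S_{A'}` and `i ≥ 1`, then
`θ_0 (θ_0 - 1) ⋯ (θ_0 - i + 1) r = x_0^i ∂_0^i r ≡ x_0^i r'` lies in `W`. Hence the falling factorial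
`[θ_0]_k` multiplies `J_{A,0}` into `W` when `J_{A,0}` is the sum of the first `k` of the ideals
`J_{A,0;i}`. Let `q` be a polynomial on `ℂ^d` that vanishes on the degrees of `S_{A'} / J̄_{A,0}`, and
substitute for its variables the parts of the Euler operators that do not involve `θ_0`. The result
is a polynomial in `θ_1, …, θ_n`; normally ordered, it is a combination of the operators
`x^u ∂^u`, which are the products of falling factorials in the `θ_j`. As the polynomial vanishes at
every `u ∈ ℕ^n` with `∂^u ∉ J_{A,0}`, only the `u` with `∂^u ∈ J_{A,0}` occur
(`mem_span_descProd_of_eval_eq_zero`). On the other hand, modulo `H_A(β)` the result is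
`q(β - θ_0 a_0)`. Therefore `[s]_k q(β - s a_0)` lies in the ideal
(`GKZ.descPochhammer_mul_restrictLine_mem_bIdeal`), which gives the bound.

*Existence.* Some `q` as above does not vanish identically on the line `β - s a_0`
(`GKZ.exists_mem_vanishingIdeal_restrictLine_ne_zero`). For a set `σ` of columns on which `a_0` is
rationally dependent there is `∂^u ∈ J_{A,0}` with `u` supported on `σ`. So if `∂^w ∉ J_{A,0}`, then
`a_0` is independent of the columns at which `w` is large, and a linear form that vanishes on those
columns but not on `a_0` takes finitely many values on the degrees of such monomials.

*The extreme cases.* If `a_0` lies in the real cone over `A'`, it lies in the rational one, so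
`k a_0 ∈ ℕ A'` for some `k ≥ 1`; then `∂_0^k ∈ S_{A'}` and `[s]_k` is in the ideal. If
`dim S_A = dim S_{A'} + 1`, then `a_0` is rationally independent of `A'`, since otherwise `S_A` would
be algebraic over `S_{A'}` and the dimensions, being transcendence degrees, would agree. A linear
form isolating `a_0` puts `s - ε` into the ideal. The ideal is proper: the Weyl algebra acts on
functions on `ℂ^{n+1}` through `(∂_j F)(w) = F(w + e_j)` and `(x_j F)(w) = w_j F(w - e_j)`, the
indicator function of `{w | A w = β}` is killed by `H_A(β)` and supported on `w_0 = ε`, and `V^1 D`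
moves it off this hyperplane (`GKZ.one_notMem_bIdeal`).
-/

noncomputable section

/-! ### Polynomials in commuting elements -/

open scoped IsMulCommutative in
/-- Evaluation of polynomials at a family of pairwise commuting elements of a ring that need not
be commutative. It is the usual evaluation in the commutative subalgebra generated by the
family. -/
def commAeval {ι B : Type*} [Ring B] [Algebra ℂ B] (f : ι → B)
    (hf : ∀ i j, f i * f j = f j * f i) : MvPolynomial ι ℂ →ₐ[ℂ] B :=
  haveI := Algebra.isMulCommutative_adjoin ℂ (s := Set.range f)
    (by rintro _ ⟨i, rfl⟩ _ ⟨j, rfl⟩; exact hf i j)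
  (Algebra.adjoin ℂ (Set.range f)).val.comp
    (aeval fun i => (⟨f i, Algebra.subset_adjoin ⟨i, rfl⟩⟩ : Algebra.adjoin ℂ (Set.range f)))

open scoped IsMulCommutative in
@[simp]
theorem commAeval_X {ι B : Type*} [Ring B] [Algebra ℂ B] (f : ι → B)
    (hf : ∀ i j, f i * f j = f j * f i) (i : ι) : commAeval f hf (X i) = f i := by
  have := Algebra.isMulCommutative_adjoin ℂ (s := Set.range f)
    (by rintro _ ⟨i, rfl⟩ _ ⟨j, rfl⟩; exact hf i j)
  change (Algebra.adjoin ℂ (Set.range f)).val (aeval _ (X i)) = f i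
  rw [aeval_X]
  rfl

namespace GKZ

theorem mono_eq_list_prod {m : ℕ} (u : Fin m → ℕ) :
    mono u = (List.ofFn fun j => (X j : R m) ^ u j).prod := by
  rw [List.prod_ofFn, mono]

theorem mono_add {m : ℕ} (u v : Fin m → ℕ) : mono (u + v) = mono u * mono v := by
  simp [mono, pow_add, Finset.prod_mul_distrib]

@[simp]
theorem mono_zero {m : ℕ} : mono (0 : Fin m → ℕ) = 1 := by
  simp [mono]

theorem mono_single {m : ℕ} (j : Fin m) (k : ℕ) : mono (Pi.single j k) = (X j : R m) ^ k := by
  rw [mono, Finset.prod_eq_single j] <;> simp +contextual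

theorem monomial_eq_smul_mono {m : ℕ} (u : Fin m →₀ ℕ) (c : ℂ) :
    monomial u c = c • mono (u : Fin m → ℕ) := by
  rw [monomial_eq, C_mul', mono, Finsupp.prod_fintype _ _ (by simp)]

theorem mono_eq_monomial {m : ℕ} (u : Fin m → ℕ) :
    mono u = monomial (Finsupp.equivFunOnFinite.symm u) (1 : ℂ) := by
  rw [monomial_eq_smul_mono, one_smul]; rfl

theorem span_range_mono (m : ℕ) : Submodule.span ℂ (Set.range (mono (m := m))) = ⊤ := by
  refine eq_top_iff.2 fun p _ => ?_
  induction p using MvPolynomial.induction_on' with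
  | monomial u c =>
    rw [monomial_eq_smul_mono]
    exact Submodule.smul_mem _ _ (Submodule.subset_span ⟨_, rfl⟩)
  | add p q hp hq => exact add_mem (hp trivial) (hq trivial)

theorem polyInclusion_mono {n : ℕ} (u : Fin n → ℕ) :
    polyInclusion n (mono u) = mono (Fin.cons 0 u) := by
  simp [polyInclusion, mono, Fin.prod_univ_succ]

end GKZ

theorem commAeval_mono {m : ℕ} {B : Type*} [Ring B] [Algebra ℂ B] (f : Fin m → B)
    (hf : ∀ i j, f i * f j = f j * f i) (u : Fin m → ℕ) :
    commAeval f hf (GKZ.mono u) = (List.ofFn fun j => f j ^ u j).prod := by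
  rw [GKZ.mono_eq_list_prod, map_list_prod, List.map_ofFn]
  congr 2
  funext j
  simp

/-! ### Commutation in the Weyl algebra -/

namespace Weyl

variable {m : ℕ}

theorem x_mul_x (i j : Fin m) : x i * x j = x j * x i := by
  simpa [x] using RingQuot.mkAlgHom_rel ℂ (WeylRel.x_comm i j)

theorem del_mul_del (i j : Fin m) : del i * del j = del j * del i := by
  simpa [del] using RingQuot.mkAlgHom_rel ℂ (WeylRel.del_comm i j)

theorem del_mul_x (i j : Fin m) : del i * x j = x j * del i + if i = j then 1 else 0 := by
  have h := RingQuot.mkAlgHom_rel ℂ (WeylRel.del_x i j)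
  rw [map_mul, map_add, map_mul] at h
  rw [del, x, h]
  split_ifs <;> simp

/-- Polynomials in the coordinates as differential operators. -/
def xHom (m : ℕ) : MvPolynomial (Fin m) ℂ →ₐ[ℂ] Weyl m := commAeval x x_mul_x

/-- Operators with constant coefficients. -/
def delHom (m : ℕ) : MvPolynomial (Fin m) ℂ →ₐ[ℂ] Weyl m := commAeval del del_mul_del

@[simp]
theorem xHom_X (j : Fin m) : xHom m (X j) = x j := commAeval_X _ _ _

@[simp]
theorem delHom_X (j : Fin m) : delHom m (X j) = del j := commAeval_X _ _ _

theorem xHom_mono (u : Fin m → ℕ) : xHom m (GKZ.mono u) = xPow u := commAeval_mono _ _ _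

theorem delHom_mono (u : Fin m → ℕ) : delHom m (GKZ.mono u) = delPow u := commAeval_mono _ _ _

theorem xPow_add (u v : Fin m → ℕ) : xPow (u + v) = xPow u * xPow v := by
  simp only [← xHom_mono, GKZ.mono_add, map_mul]

theorem delPow_add (u v : Fin m → ℕ) : delPow (u + v) = delPow u * delPow v := by
  simp only [← delHom_mono, GKZ.mono_add, map_mul]

theorem xPow_single (j : Fin m) (k : ℕ) : xPow (Pi.single j k) = x j ^ k := by
  rw [← xHom_mono, GKZ.mono_single, map_pow, xHom_X]

theorem delPow_single (j : Fin m) (k : ℕ) : delPow (Pi.single j k) = del j ^ k := by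
  rw [← delHom_mono, GKZ.mono_single, map_pow, delHom_X]

/-- The operator `θ_j = x_j ∂_j`. -/
def theta (j : Fin m) : Weyl m := x j * del j

theorem theta_mul_x (i j : Fin m) :
    theta i * x j = x j * (theta i + if i = j then 1 else 0) := by
  rw [theta, mul_assoc, del_mul_x, mul_add, ← mul_assoc, x_mul_x, mul_assoc, mul_add]
  split_ifs with h
  · rw [h]
  · simp

theorem theta_mul_theta (i j : Fin m) : theta i * theta j = theta j * theta i := by
  rcases eq_or_ne i j with rfl | h
  · rfl
  · have h₁ : del i * x j = x j * del i := by simp [del_mul_x, h]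
    have h₂ : del j * x i = x i * del j := by simp [del_mul_x, h.symm]
    calc x i * del i * (x j * del j) = x i * (del i * x j) * del j := by simp only [mul_assoc]
      _ = (x i * x j) * (del i * del j) := by rw [h₁]; simp only [mul_assoc]
      _ = x j * (x i * del j) * del i := by rw [x_mul_x, del_mul_del]; simp only [mul_assoc]
      _ = x j * del j * (x i * del i) := by rw [← h₂]; simp only [mul_assoc]

/-- Polynomials in the commuting operators `θ_j`. -/
def thetaHom (m : ℕ) : MvPolynomial (Fin m) ℂ →ₐ[ℂ] Weyl m := commAeval theta theta_mul_theta

@[simp]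
theorem thetaHom_X (j : Fin m) : thetaHom m (X j) = theta j := commAeval_X _ _ _

theorem theta_mul_x_pow (i j : Fin m) (k : ℕ) :
    theta i * x j ^ k = x j ^ k * (theta i + if i = j then (k : Weyl m) else 0) := by
  induction k with
  | zero => simp
  | succ k ih =>
    rw [pow_succ, ← mul_assoc, ih]
    by_cases h : i = j
    · subst h
      have hc : (k : Weyl m) * x i = x i * k := Nat.cast_commute k (x i)
      rw [if_pos rfl, mul_assoc, add_mul, theta_mul_x, hc, mul_assoc, if_pos rfl, if_pos rfl,
        ← mul_add, Nat.cast_succ, add_right_comm, add_assoc]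
    · rw [if_neg h, add_zero, mul_assoc, theta_mul_x, if_neg h, if_neg h, mul_assoc]

theorem theta_mul_xHom_prod (i : Fin m) (s : Finset (Fin m)) (u : Fin m → ℕ) :
    theta i * xHom m (∏ j ∈ s, X j ^ u j) =
      xHom m (∏ j ∈ s, X j ^ u j) * (theta i + if i ∈ s then (u i : Weyl m) else 0) := by
  induction s using Finset.induction_on with
  | empty => simp
  | insert a s ha ih =>
    rw [Finset.prod_insert ha, mul_comm, map_mul, ← mul_assoc, ih, mul_assoc, mul_assoc]
    congr 1
    simp only [map_pow, xHom_X]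
    rcases eq_or_ne i a with rfl | h
    · simp [ha, theta_mul_x_pow]
    · have hc : (u i : Weyl m) * x a ^ u a = x a ^ u a * u i := Nat.cast_commute _ _
      by_cases hs : i ∈ s <;> simp [add_mul, mul_add, theta_mul_x_pow, h, hs, hc]

theorem theta_mul_xPow (i : Fin m) (u : Fin m → ℕ) :
    theta i * xPow u = xPow u * (theta i + (u i : Weyl m)) := by
  simpa [← xHom_mono, GKZ.mono] using theta_mul_xHom_prod i Finset.univ u

/-- The identity `θ (θ - 1) ⋯ (θ - k + 1) = x^k ∂^k`. -/
theorem aeval_theta_descPochhammer (j : Fin m) (k : ℕ) :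
    Polynomial.aeval (theta j) (descPochhammer ℂ k) = x j ^ k * del j ^ k := by
  induction k with
  | zero => simp
  | succ k ih =>
    have h : theta j * x j ^ k = x j ^ k * theta j + x j ^ k * (k : Weyl m) := by
      rw [theta_mul_x_pow, if_pos rfl, mul_add]
    have hc : (k : Weyl m) * x j ^ k = x j ^ k * k := Nat.cast_commute _ _
    rw [descPochhammer_succ_right, mul_comm, map_mul, ih, map_sub, Polynomial.aeval_X, map_natCast,
      ← mul_assoc, sub_mul, h, hc, add_sub_cancel_right, theta, pow_succ, pow_succ']
    simp only [mul_assoc]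

theorem aeval_theta_mul_of_commute {i : Fin m} {y : Weyl m} (h : theta i * y = y * theta i)
    (p : Polynomial ℂ) :
    Polynomial.aeval (theta i) p * y = y * Polynomial.aeval (theta i) p := by
  induction p using Polynomial.induction_on' with
  | add p q hp hq => rw [map_add, add_mul, hp, hq, mul_add]
  | monomial k a =>
    have hk : theta i ^ k * y = y * theta i ^ k := Commute.pow_left h k
    rw [Polynomial.aeval_monomial, mul_assoc, hk, ← mul_assoc, Algebra.commutes, mul_assoc]

end Weyl

/-! ### Falling factorials in several variables -/

/-- The product of falling factorials `∏_j X_j (X_j - 1) ⋯ (X_j - u_j + 1)`. -/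
def descProd {m : ℕ} (u : Fin m → ℕ) : MvPolynomial (Fin m) ℂ :=
  ∏ j, Polynomial.aeval (X j) (descPochhammer ℂ (u j))

theorem X_mul_descProd {m : ℕ} (j : Fin m) (u : Fin m → ℕ) :
    X j * descProd u = descProd (u + Pi.single j 1) + (u j : ℂ) • descProd u := by
  have h : descProd (u + Pi.single j 1) = descProd u * (X j - (u j : MvPolynomial (Fin m) ℂ)) := by
    rw [descProd, descProd, ← Finset.mul_prod_erase _ _ (Finset.mem_univ j),
      ← Finset.mul_prod_erase _ (fun i => Polynomial.aeval (X i) (descPochhammer ℂ (u i)))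
        (Finset.mem_univ j)]
    have h₁ : ∏ i ∈ Finset.univ.erase j, Polynomial.aeval (X i : MvPolynomial (Fin m) ℂ)
          (descPochhammer ℂ ((u + Pi.single j 1 : Fin m → ℕ) i)) =
        ∏ i ∈ Finset.univ.erase j, Polynomial.aeval (X i) (descPochhammer ℂ (u i)) := by
      refine Finset.prod_congr rfl fun i hi => ?_
      simp [Finset.ne_of_mem_erase hi]
    rw [h₁, Pi.add_apply, Pi.single_eq_same, descPochhammer_succ_right]
    simp only [map_mul, map_sub, Polynomial.aeval_X, map_natCast]
    ring
  rw [h, smul_eq_C_mul, map_natCast]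
  ring

theorem span_range_descProd (m : ℕ) : Submodule.span ℂ (Set.range (descProd (m := m))) = ⊤ := by
  refine Submodule.eq_top_iff'.2 fun p => ?_
  induction p using MvPolynomial.induction_on with
  | C a =>
    have h : (C a : MvPolynomial (Fin m) ℂ) = a • descProd (0 : Fin m → ℕ) := by
      simp [descProd, smul_eq_C_mul]
    rw [h]
    exact Submodule.smul_mem _ _ (Submodule.subset_span ⟨_, rfl⟩)
  | add p q hp hq => exact add_mem hp hq
  | mul_X p j hp =>
    rw [mul_comm]
    induction hp using Submodule.span_induction with
    | mem p hp =>
      obtain ⟨u, rfl⟩ := hp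
      rw [X_mul_descProd]
      exact add_mem (Submodule.subset_span ⟨_, rfl⟩)
        (Submodule.smul_mem _ _ (Submodule.subset_span ⟨_, rfl⟩))
    | zero => simp
    | add p q _ _ hp hq => rw [mul_add]; exact add_mem hp hq
    | smul c p _ hp => rw [mul_smul_comm]; exact Submodule.smul_mem _ c hp

theorem eval_natCast_descProd {m : ℕ} (u w : Fin m → ℕ) :
    eval (fun j => (w j : ℂ)) (descProd u) = ∏ j, ((w j).descFactorial (u j) : ℂ) := by
  rw [descProd, map_prod]
  refine Finset.prod_congr rfl fun j _ => ?_
  rw [← descPochhammer_eval_eq_descFactorial, ← coe_aeval_eq_eval, RingHom.coe_coe,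
    ← Polynomial.aeval_algHom_apply, aeval_X, Polynomial.coe_aeval_eq_eval]

/-- A polynomial that vanishes at all points of `ℕ^m` outside an upper set `U` is a combination of
the falling factorial products indexed by `U`: a minimal index outside `U` that occurs would be a
point where the polynomial does not vanish. -/
theorem mem_span_descProd_of_eval_eq_zero {m : ℕ} {U : Set (Fin m → ℕ)} (hU : IsUpperSet U)
    (g : MvPolynomial (Fin m) ℂ) (hg : ∀ u ∉ U, eval (fun j => (u j : ℂ)) g = 0) :
    g ∈ Submodule.span ℂ (descProd '' U) := by
  have hgs : g ∈ Submodule.span ℂ (Set.range (descProd (m := m))) := by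
    rw [span_range_descProd]; trivial
  obtain ⟨c, rfl⟩ := Finsupp.mem_span_range_iff_exists_finsupp.1 hgs
  have key : ∀ u, u ∉ U → c u = 0 := by
    intro u
    induction u using WellFoundedLT.induction with
    | ind u ih =>
      intro hu
      have h := hg u hu
      rw [Finsupp.sum, map_sum, Finset.sum_eq_single u] at h
      · rw [smul_eval, eval_natCast_descProd, mul_eq_zero] at h
        refine h.resolve_right ?_
        simp [Finset.prod_eq_zero_iff, Nat.descFactorial_self, Nat.factorial_ne_zero]
      · intro w _ hwu
        rw [smul_eval, eval_natCast_descProd]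
        by_cases hle : w ≤ u
        · rw [ih w (lt_of_le_of_ne hle hwu) fun hw => hu (hU hle hw), zero_mul]
        · obtain ⟨j, hj⟩ := not_forall.1 hle
          rw [Finset.prod_eq_zero (Finset.mem_univ j), mul_zero]
          rw [Nat.descFactorial_eq_zero_iff_lt.2 (not_le.1 hj), Nat.cast_zero]
      · intro hc
        rw [Finsupp.notMem_support_iff.1 hc, zero_smul, map_zero]
  refine Submodule.sum_mem _ fun u hu => Submodule.smul_mem _ _ (Submodule.subset_span ⟨u, ?_, rfl⟩)
  by_contra h
  exact Finsupp.mem_support_iff.1 hu (key u h)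

namespace Weyl

variable {m : ℕ}

theorem thetaHom_prod (s : Finset (Fin m)) (u : Fin m → ℕ) :
    thetaHom m (∏ j ∈ s, Polynomial.aeval (X j) (descPochhammer ℂ (u j))) =
      xHom m (∏ j ∈ s, X j ^ u j) * delHom m (∏ j ∈ s, X j ^ u j) := by
  induction s using Finset.induction_on with
  | empty => simp
  | insert a s ha ih =>
    have hc : theta a * xHom m (∏ j ∈ s, X j ^ u j) = xHom m (∏ j ∈ s, X j ^ u j) * theta a := by
      simpa [ha] using theta_mul_xHom_prod a s u
    rw [Finset.prod_insert ha, map_mul, ih, ← Polynomial.aeval_algHom_apply, thetaHom_X, ← mul_assoc,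
      aeval_theta_mul_of_commute hc, aeval_theta_descPochhammer, Finset.prod_insert ha,
      mul_comm (X a ^ u a) (∏ j ∈ s, X j ^ u j), map_mul (xHom m), mul_comm (∏ j ∈ s, X j ^ u j),
      map_mul (delHom m)]
    simp only [map_pow, xHom_X, delHom_X, mul_assoc]

/-- The normally ordered monomials `x^u ∂^u` are the falling factorials in the `θ_j`. -/
theorem thetaHom_descProd (u : Fin m → ℕ) : thetaHom m (descProd u) = xPow u * delPow u := by
  rw [descProd, thetaHom_prod, ← xHom_mono, ← delHom_mono, GKZ.mono]

/-! ### Stability of the `V`-filtration -/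

theorem monomial_mem_V {t : Fin m} {i : ℤ} {α γ : Fin m → ℕ} (h : i ≤ (α t : ℤ) - γ t) :
    xPow α * delPow γ ∈ V t i :=
  Submodule.subset_span ⟨α, γ, h, rfl⟩

theorem xPow_mul_mem_V {t : Fin m} {i : ℤ} (u : Fin m → ℕ) {P : Weyl m} (hP : P ∈ V t i) :
    xPow u * P ∈ V t i := by
  induction hP using Submodule.span_induction with
  | mem P hP =>
    obtain ⟨α, γ, h, rfl⟩ := hP
    rw [← mul_assoc, ← xPow_add]
    refine monomial_mem_V ?_
    simp only [Pi.add_apply, Nat.cast_add]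
    lia
  | zero => simp
  | add P Q _ _ hP hQ => rw [mul_add]; exact add_mem hP hQ
  | smul c P _ hP => rw [mul_smul_comm]; exact Submodule.smul_mem _ c hP

theorem theta_mul_mem_V {t : Fin m} {i : ℤ} (j : Fin m) {P : Weyl m} (hP : P ∈ V t i) :
    theta j * P ∈ V t i := by
  induction hP using Submodule.span_induction with
  | mem P hP =>
    obtain ⟨α, γ, h, rfl⟩ := hP
    have e : theta j * (xPow α * delPow γ) =
        xPow (α + Pi.single j 1) * delPow (γ + Pi.single j 1) + (α j : ℂ) • (xPow α * delPow γ) := by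
      rw [← mul_assoc, theta_mul_xPow, xPow_add, add_comm γ, delPow_add, xPow_single, delPow_single,
        pow_one, pow_one, mul_add, add_mul, theta, Algebra.smul_def, map_natCast,
        ← (Nat.cast_commute (α j) (xPow α)).eq]
      simp only [mul_assoc]
    rw [e]
    refine add_mem (monomial_mem_V ?_) (Submodule.smul_mem _ _ (monomial_mem_V h))
    simp only [Pi.add_apply, Nat.cast_add]
    lia
  | zero => simp
  | add P Q _ _ hP hQ => rw [mul_add]; exact add_mem hP hQ
  | smul c P _ hP => rw [mul_smul_comm]; exact Submodule.smul_mem _ c hP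

end Weyl

namespace GKZ

variable {d m n : ℕ}

/-! ### The ideal of polynomials satisfying the `b`-function equation -/

/-- The subspace `H_A(β) + V^1 D` of the Weyl algebra. -/
def hypergeometricAddV (A : Matrix (Fin d) (Fin m) ℤ) (β : Fin d → ℂ) (t : Fin m) :
    Submodule ℂ (Weyl m) :=
  (hypergeometricIdeal A β).restrictScalars ℂ ⊔ Weyl.V t 1

variable {A : Matrix (Fin d) (Fin m) ℤ} {β : Fin d → ℂ} {t : Fin m}

theorem mem_hypergeometricAddV_of_mem_ideal {P : Weyl m} (h : P ∈ hypergeometricIdeal A β) :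
    P ∈ hypergeometricAddV A β t :=
  Submodule.mem_sup_left h

theorem mem_hypergeometricAddV_of_mem_V {P : Weyl m} (h : P ∈ Weyl.V t 1) :
    P ∈ hypergeometricAddV A β t :=
  Submodule.mem_sup_right h

theorem mul_mem_hypergeometricAddV {T P : Weyl m}
    (hT : ∀ Q ∈ Weyl.V t 1, T * Q ∈ Weyl.V t 1) (hP : P ∈ hypergeometricAddV A β t) :
    T * P ∈ hypergeometricAddV A β t := by
  obtain ⟨h, hh, v, hv, rfl⟩ := Submodule.mem_sup.1 hP
  rw [mul_add]
  exact add_mem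
    (mem_hypergeometricAddV_of_mem_ideal (Submodule.smul_mem (hypergeometricIdeal A β) T hh))
    (mem_hypergeometricAddV_of_mem_V (hT v hv))

theorem xPow_mul_mem_hypergeometricAddV (u : Fin m → ℕ) {P : Weyl m}
    (hP : P ∈ hypergeometricAddV A β t) : Weyl.xPow u * P ∈ hypergeometricAddV A β t :=
  mul_mem_hypergeometricAddV (fun _ => Weyl.xPow_mul_mem_V u) hP

theorem aeval_theta_mul_mem_hypergeometricAddV (j : Fin m) (p : Polynomial ℂ) {P : Weyl m}
    (hP : P ∈ hypergeometricAddV A β t) :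
    Polynomial.aeval (Weyl.theta j) p * P ∈ hypergeometricAddV A β t := by
  induction p using Polynomial.induction_on generalizing P with
  | C a =>
    rw [Polynomial.aeval_C, ← Algebra.smul_def]
    exact Submodule.smul_mem _ a hP
  | add p q hp hq => rw [map_add, add_mul]; exact add_mem (hp hP) (hq hP)
  | monomial k a h =>
    rw [pow_succ, ← mul_assoc, map_mul, Polynomial.aeval_X, mul_assoc]
    exact h (mul_mem_hypergeometricAddV (fun _ => Weyl.theta_mul_mem_V j) hP)

/-- The ideal of all `b` with `b(θ_t) ∈ H_A(β) + V^1 D`. -/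
def bIdeal (A : Matrix (Fin d) (Fin m) ℤ) (β : Fin d → ℂ) (t : Fin m) : Ideal (Polynomial ℂ) where
  carrier := {b | Polynomial.aeval (Weyl.theta t) b ∈ hypergeometricAddV A β t}
  add_mem' hp hq := by
    rw [Set.mem_ofPred_eq, map_add]
    exact add_mem hp hq
  zero_mem' := by
    rw [Set.mem_ofPred_eq, map_zero]
    exact zero_mem _
  smul_mem' c p hp := by
    rw [Set.mem_ofPred_eq, smul_eq_mul, map_mul]
    exact aeval_theta_mul_mem_hypergeometricAddV t c hp

theorem mem_bIdeal {b : Polynomial ℂ} :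
    b ∈ bIdeal A β t ↔ Polynomial.aeval (Weyl.theta t) b ∈ hypergeometricAddV A β t :=
  Iff.rfl

theorem bFunctionEquation_iff {b : Polynomial ℂ} :
    BFunctionEquation t ((hypergeometricIdeal A β).mkQ 1) b ↔ b ∈ bIdeal A β t := by
  have e : ∀ P : Weyl m, P • (hypergeometricIdeal A β).mkQ 1 = (hypergeometricIdeal A β).mkQ P := by
    intro P
    rw [← map_smul, smul_eq_mul, mul_one]
  simp only [BFunctionEquation, e]
  constructor
  · rintro ⟨Q, hQ, h⟩
    have h' : Polynomial.aeval (Weyl.theta t) b - Q ∈ hypergeometricIdeal A β :=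
      (Submodule.Quotient.eq _).1 h
    rw [mem_bIdeal, ← sub_add_cancel (Polynomial.aeval (Weyl.theta t) b) Q]
    exact add_mem (mem_hypergeometricAddV_of_mem_ideal h') (mem_hypergeometricAddV_of_mem_V hQ)
  · intro h
    obtain ⟨P, hP, Q, hQ, e⟩ := Submodule.mem_sup.1 h
    refine ⟨Q, hQ, (Submodule.Quotient.eq _).2 ?_⟩
    change Polynomial.aeval (Weyl.theta t) b - Q ∈ _
    rw [← e, add_sub_cancel_right]
    exact hP

theorem isHypergeometricBFunction_iff {b : Polynomial ℂ} :
    IsHypergeometricBFunction A β t b ↔ b.Monic ∧ b ∈ bIdeal A β t ∧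
      ∀ q : Polynomial ℂ, q.Monic → q ∈ bIdeal A β t → b.natDegree ≤ q.natDegree := by
  simp only [IsHypergeometricBFunction, IsBFunction, bFunctionEquation_iff]

/-- The `b`-function divides every polynomial that satisfies its defining relation. -/
theorem IsHypergeometricBFunction.dvd {b : Polynomial ℂ} (hb : IsHypergeometricBFunction A β t b)
    {p : Polynomial ℂ} (hp : p ∈ bIdeal A β t) : b ∣ p := by
  obtain ⟨hm, hbI, hmin⟩ := isHypergeometricBFunction_iff.1 hb
  rw [← Polynomial.modByMonic_eq_zero_iff_dvd hm]
  by_contra h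
  have hr : p %ₘ b ∈ bIdeal A β t := by
    rw [Polynomial.modByMonic_eq_sub_mul_div]
    exact sub_mem hp (Ideal.mul_mem_right _ _ hbI)
  have hn := hmin (normalize (p %ₘ b)) (Polynomial.monic_normalize h)
    ((normalize_associated (p %ₘ b)).symm.dvd.elim fun c hc => hc ▸ Ideal.mul_mem_right _ _ hr)
  rw [Polynomial.natDegree_eq_of_degree_eq Polynomial.degree_normalize] at hn
  have hb1 : b ≠ 1 := by
    rintro rfl
    simp at h
  exact (Polynomial.natDegree_modByMonic_lt p hm hb1).not_ge hn

theorem existsUnique_isHypergeometricBFunction (h : bIdeal A β t ≠ ⊥) :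
    ∃! b, IsHypergeometricBFunction A β t b := by
  set g := Submodule.IsPrincipal.generator (bIdeal A β t)
  have hg : g ≠ 0 := fun h0 => h ((Submodule.IsPrincipal.eq_bot_iff_generator_eq_zero _).2 h0)
  have hgI : normalize g ∈ bIdeal A β t :=
    (normalize_associated g).symm.dvd.elim fun c hc =>
      hc ▸ Ideal.mul_mem_right _ _ (Submodule.IsPrincipal.generator_mem _)
  have hb : IsHypergeometricBFunction A β t (normalize g) := by
    refine isHypergeometricBFunction_iff.2 ⟨Polynomial.monic_normalize hg, hgI, fun q hq hqI => ?_⟩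
    refine Polynomial.natDegree_le_of_dvd ?_ hq.ne_zero
    exact (normalize_associated g).dvd.trans ((Submodule.IsPrincipal.mem_iff_generator_dvd _).1 hqI)
  refine ⟨_, hb, fun b hb' => ?_⟩
  have h₁ := isHypergeometricBFunction_iff.1 hb'
  exact Polynomial.eq_of_monic_of_associated h₁.1 (Polynomial.monic_normalize hg)
    (associated_of_dvd_dvd (hb'.dvd hgI) (hb.dvd h₁.2.1))

end GKZ

namespace GKZ

variable {d m n : ℕ}

/-! ### Toric ideals in the Weyl algebra -/

/-- The degree `A u ∈ ℤ^d` of the monomial `∂^u`. -/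
def monoDegree (A : Matrix (Fin d) (Fin m) ℤ) (u : Fin m → ℕ) : Fin d → ℤ :=
  A *ᵥ fun j => (u j : ℤ)

theorem monoDegree_apply (A : Matrix (Fin d) (Fin m) ℤ) (u : Fin m → ℕ) (i : Fin d) :
    monoDegree A u i = ∑ j, A i j * (u j : ℤ) := rfl

theorem monoDegree_add (A : Matrix (Fin d) (Fin m) ℤ) (u v : Fin m → ℕ) :
    monoDegree A (u + v) = monoDegree A u + monoDegree A v := by
  ext i
  simp [monoDegree_apply, mul_add, Finset.sum_add_distrib]

theorem monoDegree_cons (A : Matrix (Fin d) (Fin (n + 1)) ℤ) (k : ℕ) (u : Fin n → ℕ) :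
    monoDegree A (Fin.cons k u) = k • A.col 0 + monoDegree (dropFirst A) u := by
  ext i
  simp [monoDegree_apply, Fin.sum_univ_succ, dropFirst, Matrix.col, mul_comm]

theorem mono_cons (k : ℕ) (u : Fin n → ℕ) :
    mono (Fin.cons k u) = (X 0 : R (n + 1)) ^ k * polyInclusion n (mono u) := by
  rw [polyInclusion_mono]
  simp [mono, Fin.prod_univ_succ]

/-- Monomials of equal degree agree modulo the toric ideal. -/
theorem mono_sub_mono_mem_toricIdeal {A : Matrix (Fin d) (Fin m) ℤ} {u w : Fin m → ℕ}
    (h : monoDegree A u = monoDegree A w) : mono u - mono w ∈ toricIdeal A := by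
  set v : Fin m → ℤ := fun j => (u j : ℤ) - w j
  have hv : A *ᵥ v = 0 := by
    have : v = (fun j => (u j : ℤ)) - fun j => (w j : ℤ) := rfl
    rw [this, Matrix.mulVec_sub, sub_eq_zero]
    exact h
  have hu : u = (fun j => min (u j) (w j)) + posPart v := by
    ext j; simp only [posPart, Pi.add_apply, v]; lia
  have hw : w = (fun j => min (u j) (w j)) + negPart v := by
    ext j; simp only [negPart, Pi.add_apply, v]; lia
  have e : mono u - mono w =
      mono (fun j => min (u j) (w j)) * (mono (posPart v) - mono (negPart v)) := by
    rw [mul_sub, ← mono_add, ← mono_add, ← hu, ← hw]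
  rw [e]
  exact Ideal.mul_mem_left _ _ (Ideal.subset_span ⟨v, hv, rfl⟩)

theorem delHom_mem_hypergeometricIdeal {A : Matrix (Fin d) (Fin m) ℤ} (β : Fin d → ℂ) {r : R m}
    (hr : r ∈ toricIdeal A) : Weyl.delHom m r ∈ hypergeometricIdeal A β := by
  rw [toricIdeal] at hr
  induction hr using Submodule.span_induction with
  | mem r hr =>
    obtain ⟨v, hv, rfl⟩ := hr
    rw [map_sub, Weyl.delHom_mono, Weyl.delHom_mono]
    exact Submodule.subset_span (Or.inr ⟨v, hv, rfl⟩)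
  | zero => simp
  | add p q _ _ hp hq => rw [map_add]; exact add_mem hp hq
  | smul c p _ hp =>
    rw [smul_eq_mul, map_mul]
    exact Submodule.smul_mem _ (Weyl.delHom m c) hp

theorem toricInclusion_mk (A : Matrix (Fin d) (Fin (n + 1)) ℤ) (r : R n) :
    toricInclusion A (Ideal.Quotient.mk _ r) = Ideal.Quotient.mk _ (polyInclusion n r) := by
  exact Ideal.quotientMap_mk

theorem polyInclusion_mem_toricIdeal {A : Matrix (Fin d) (Fin (n + 1)) ℤ} {r : R n}
    (hr : r ∈ toricIdeal (dropFirst A)) : polyInclusion n r ∈ toricIdeal A :=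
  toricIdeal_dropFirst_le A hr

/-- Operators of the form `x_0^i r(∂_1, …, ∂_n)` have order at least `i` along `x_0 = 0`. -/
theorem x_pow_mul_delHom_polyInclusion_mem_V (i : ℕ) (r : R n) :
    Weyl.x 0 ^ i * Weyl.delHom (n + 1) (polyInclusion n r) ∈ Weyl.V 0 i := by
  have hr : r ∈ Submodule.span ℂ (Set.range (mono (m := n))) := by
    rw [span_range_mono]; trivial
  induction hr using Submodule.span_induction with
  | mem r hr =>
    obtain ⟨u, rfl⟩ := hr
    rw [polyInclusion_mono, Weyl.delHom_mono, ← Weyl.xPow_single]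
    refine Weyl.monomial_mem_V ?_
    simp
  | zero => simp
  | add p q _ _ hp hq => rw [map_add, map_add, mul_add]; exact add_mem hp hq
  | smul c p _ hp =>
    rw [map_smul, map_smul, mul_smul_comm]
    exact Submodule.smul_mem _ c hp

/-! ### Annihilation of the ideals `J_{A,0;i}` -/

variable {A : Matrix (Fin d) (Fin (n + 1)) ℤ} (β : Fin d → ℂ)

/-- If `∂_0^i r ∈ S_{A'}`, then `θ_0 (θ_0 - 1) ⋯ (θ_0 - i + 1) r = x_0^i (∂_0^i r)` lies in `V^i D`
modulo the hypergeometric ideal. -/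
theorem descPochhammer_mul_mem_of_mem_jLevel {i : ℕ} (hi : 1 ≤ i) {r : R n} (hr : r ∈ jLevel A i) :
    Polynomial.aeval (Weyl.theta 0) (descPochhammer ℂ i) *
      Weyl.delHom (n + 1) (polyInclusion n r) ∈ hypergeometricAddV A β 0 := by
  set L : Submodule ℂ (R n) := (hypergeometricAddV A β 0).comap
    ((LinearMap.mulLeft ℂ (Polynomial.aeval (Weyl.theta 0) (descPochhammer ℂ i))).comp
      ((Weyl.delHom (n + 1)).comp (polyInclusion n)).toLinearMap)
  change r ∈ L
  have hI : ∀ p ∈ toricIdeal (dropFirst A), p ∈ L := fun p hp =>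
    mem_hypergeometricAddV_of_mem_ideal (Submodule.smul_mem (hypergeometricIdeal A β)
      (Polynomial.aeval (Weyl.theta 0) (descPochhammer ℂ i))
      (delHom_mem_hypergeometricIdeal β (polyInclusion_mem_toricIdeal hp)))
  have key : ∀ p ∈ Submodule.span ℂ (jMonomials A i), ∃ r ∈ L, Ideal.Quotient.mk _ r = p := by
    intro p hp
    induction hp using Submodule.span_induction with
    | mem p hp =>
      obtain ⟨u, rfl, q, hq⟩ := hp
      refine ⟨mono u, ?_, rfl⟩
      obtain ⟨q, rfl⟩ := Ideal.Quotient.mk_surjective q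
      rw [toricInclusion_mk, toricInclusion_mk, ← map_pow, ← map_mul, Ideal.Quotient.eq] at hq
      change Polynomial.aeval (Weyl.theta 0) (descPochhammer ℂ i) *
        Weyl.delHom (n + 1) (polyInclusion n (mono u)) ∈ hypergeometricAddV A β 0
      have e : Polynomial.aeval (Weyl.theta 0) (descPochhammer ℂ i) *
          Weyl.delHom (n + 1) (polyInclusion n (mono u)) =
          Weyl.x 0 ^ i * Weyl.delHom (n + 1) (polyInclusion n q) -
          Weyl.x 0 ^ i * Weyl.delHom (n + 1)
            (polyInclusion n q - X 0 ^ i * polyInclusion n (mono u)) := by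
        rw [Weyl.aeval_theta_descPochhammer, ← mul_sub, ← map_sub, sub_sub_cancel, map_mul, map_pow,
          Weyl.delHom_X, mul_assoc]
      rw [e]
      refine sub_mem (mem_hypergeometricAddV_of_mem_V ?_) (mem_hypergeometricAddV_of_mem_ideal
        (Submodule.smul_mem _ (Weyl.x 0 ^ i) (delHom_mem_hypergeometricIdeal β hq)))
      refine Submodule.span_mono ?_ (x_pow_mul_delHom_polyInclusion_mem_V i q)
      rintro _ ⟨α, γ, h, rfl⟩
      exact ⟨α, γ, by lia, rfl⟩
    | zero => exact ⟨0, zero_mem _, map_zero _⟩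
    | add p q _ _ hp hq =>
      obtain ⟨p, hp, rfl⟩ := hp
      obtain ⟨q, hq, rfl⟩ := hq
      exact ⟨p + q, add_mem hp hq, map_add _ _ _⟩
    | smul c p _ hp =>
      obtain ⟨p, hp, rfl⟩ := hp
      exact ⟨c • p, Submodule.smul_mem _ c hp, rfl⟩
  obtain ⟨r', hr', e⟩ := key _ hr
  rw [← sub_sub_cancel r' r]
  exact sub_mem hr' (hI _ (Ideal.Quotient.eq.1 e))

theorem descPochhammer_mul_mem_of_mem_jIdeal {k : ℕ}
    (hk : jIdeal A = ⨆ i ∈ Set.Icc 1 k, jLevel A i) {r : R n} (hr : r ∈ jIdeal A) :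
    Polynomial.aeval (Weyl.theta 0) (descPochhammer ℂ k) *
      Weyl.delHom (n + 1) (polyInclusion n r) ∈ hypergeometricAddV A β 0 := by
  set L : Submodule ℂ (R n) := (hypergeometricAddV A β 0).comap
    ((LinearMap.mulLeft ℂ (Polynomial.aeval (Weyl.theta 0) (descPochhammer ℂ k))).comp
      ((Weyl.delHom (n + 1)).comp (polyInclusion n)).toLinearMap)
  change r ∈ L
  rw [hk] at hr
  induction hr using Submodule.iSup_induction' with
  | mem i r hr =>
    by_cases hi : i ∈ Set.Icc 1 k
    · rw [iSup_pos hi] at hr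
      obtain ⟨p, hp⟩ : descPochhammer ℂ i ∣ descPochhammer ℂ k := by
        rw [← Nat.add_sub_of_le hi.2, ← descPochhammer_mul]
        exact dvd_mul_right _ _
      change Polynomial.aeval (Weyl.theta 0) (descPochhammer ℂ k) *
        Weyl.delHom (n + 1) (polyInclusion n r) ∈ hypergeometricAddV A β 0
      rw [hp, mul_comm, map_mul, mul_assoc]
      exact aeval_theta_mul_mem_hypergeometricAddV 0 p
        (descPochhammer_mul_mem_of_mem_jLevel β hi.1 hr)
    · rw [iSup_neg hi, Submodule.mem_bot] at hr
      rw [hr]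
      exact zero_mem _
  | zero => exact zero_mem _
  | add p q _ _ hp hq => exact add_mem hp hq

theorem mono_mem_jLevel {i : ℕ} {u w : Fin n → ℕ}
    (h : i • A.col 0 + monoDegree (dropFirst A) u = monoDegree (dropFirst A) w) :
    mono u ∈ jLevel A i := by
  refine Submodule.subset_span ⟨u, rfl, Ideal.Quotient.mk _ (mono w), ?_⟩
  rw [toricInclusion_mk, toricInclusion_mk, ← map_pow, ← map_mul, Ideal.Quotient.eq, ← mono_cons,
    polyInclusion_mono]
  refine mono_sub_mono_mem_toricIdeal ?_
  rw [monoDegree_cons, monoDegree_cons, h, zero_smul, zero_add]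

theorem jLevel_le_jIdeal {i : ℕ} (hi : 1 ≤ i) : jLevel A i ≤ jIdeal A :=
  le_iSup₂_of_le i hi le_rfl

theorem toricIdeal_le_jIdeal : toricIdeal (dropFirst A) ≤ jIdeal A := by
  refine le_trans (fun p hp => ?_) (jLevel_le_jIdeal le_rfl)
  rw [jLevel, Ideal.mem_comap, Ideal.Quotient.eq_zero_iff_mem.2 hp]
  exact zero_mem _

theorem mk_mem_barJ_iff {r : R n} : Ideal.Quotient.mk _ r ∈ barJ A ↔ r ∈ jIdeal A := by
  constructor
  · intro h
    obtain ⟨s, hs, e⟩ := (Ideal.mem_map_iff_of_surjective _ Ideal.Quotient.mk_surjective).1 h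
    rw [← sub_sub_cancel s r]
    exact sub_mem hs (toricIdeal_le_jIdeal (Ideal.Quotient.eq.1 e))
  · exact fun h => Ideal.mem_map_of_mem _ h

theorem exists_jIdeal_eq_iSup (A : Matrix (Fin d) (Fin (n + 1)) ℤ) :
    ∃ k : ℕ, jIdeal A = ⨆ i ∈ Set.Icc 1 k, jLevel A i := by
  let f : ℕ →o Ideal (R n) :=
    ⟨fun k => ⨆ i ∈ Set.Icc 1 k, jLevel A i, fun a b hab =>
      biSup_mono fun i hi => ⟨hi.1, hi.2.trans hab⟩⟩
  obtain ⟨k, hk⟩ := monotone_stabilizes_iff_noetherian.2 inferInstance f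
  refine ⟨k, le_antisymm (iSup₂_le fun i hi => ?_) (biSup_mono fun i hi => hi.1)⟩
  have h : jLevel A i ≤ f (max k i) := le_iSup₂_of_le i ⟨hi, le_max_right _ _⟩ le_rfl
  rw [← hk _ (le_max_left _ _)] at h
  exact h

/-! ### Degrees -/

theorem isWeightedHomogeneous_mono (A : Matrix (Fin d) (Fin m) ℤ) (u : Fin m → ℕ) :
    IsWeightedHomogeneous A.col (mono u : R m) (monoDegree A u) := by
  rw [mono_eq_monomial]
  refine isWeightedHomogeneous_monomial _ _ _ ?_
  rw [Finsupp.weight_apply, Finsupp.sum_fintype _ _ (by simp)]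
  ext i
  simp [monoDegree_apply, Matrix.col, mul_comm]

/-- Polynomials of degree `α` are combinations of monomials of degree `α`. -/
theorem mem_span_mono_of_isWeightedHomogeneous {A : Matrix (Fin d) (Fin m) ℤ} {p : R m}
    {α : Fin d → ℤ} (hp : IsWeightedHomogeneous A.col p α) :
    p ∈ Submodule.span ℂ (mono '' {u | monoDegree A u = α}) := by
  rw [p.as_sum]
  refine Submodule.sum_mem _ fun u hu => ?_
  rw [monomial_eq_smul_mono]
  refine Submodule.smul_mem _ _ (Submodule.subset_span ⟨u, ?_, rfl⟩)
  rw [Set.mem_ofPred_eq, ← hp (mem_support_iff.1 hu), Finsupp.weight_apply,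
    Finsupp.sum_fintype _ _ (by simp)]
  ext i
  simp [monoDegree_apply, Matrix.col, mul_comm]

/-- The degrees of `S_{A'} / J̄_{A,0}` are those of the monomials outside `J_{A,0}`. -/
theorem mem_degrees_quotientPiece_iff {α : Fin d → ℤ} :
    α ∈ degrees (quotientPiece (dropFirst A) (barJ A)) ↔
      ∃ u, mono u ∉ jIdeal A ∧ monoDegree (dropFirst A) u = α := by
  constructor
  · intro h
    by_contra! hc
    refine h ((Submodule.eq_bot_iff _).2 ?_)
    rintro _ ⟨_, ⟨p, hp, rfl⟩, rfl⟩
    change Ideal.Quotient.mk _ (Ideal.Quotient.mk _ p) = 0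
    rw [Ideal.Quotient.eq_zero_iff_mem, mk_mem_barJ_iff]
    have hs := mem_span_mono_of_isWeightedHomogeneous hp
    have hle : Submodule.span ℂ (mono '' {u | monoDegree (dropFirst A) u = α}) ≤
        (jIdeal A).restrictScalars ℂ := by
      refine Submodule.span_le.2 ?_
      rintro _ ⟨u, hu, rfl⟩
      by_contra h
      exact hc u h hu
    exact hle hs
  · rintro ⟨u, hu, rfl⟩ h
    refine hu (mk_mem_barJ_iff.1 (Ideal.Quotient.eq_zero_iff_mem.1 ?_))
    refine (Submodule.eq_bot_iff _).1 h _ ⟨_, ⟨mono u, ?_, rfl⟩, rfl⟩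
    exact isWeightedHomogeneous_mono _ u

end GKZ

namespace GKZ

variable {d m n : ℕ}

/-! ### Polynomials in the Euler operators -/

theorem thetaHom_sum_eq_euler (A : Matrix (Fin d) (Fin m) ℤ) (i : Fin d) :
    Weyl.thetaHom m (∑ j, (A i j : ℂ) • X j) = euler A i := by
  simp [euler, Weyl.theta]

theorem thetaHom_mem_hypergeometricIdeal (A : Matrix (Fin d) (Fin m) ℤ) (β : Fin d → ℂ)
    {p : MvPolynomial (Fin m) ℂ}
    (hp : p ∈ Ideal.span (Set.range fun i => ∑ j, (A i j : ℂ) • X j - C (β i))) :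
    Weyl.thetaHom m p ∈ hypergeometricIdeal A β := by
  induction hp using Submodule.span_induction with
  | mem r hr =>
    obtain ⟨i, rfl⟩ := hr
    refine Submodule.subset_span (Or.inl ⟨i, ?_⟩)
    rw [map_sub, thetaHom_sum_eq_euler]
    congr 1
    exact (Weyl.thetaHom m).commutes (β i)
  | zero => simp
  | add p q _ _ hp hq => rw [map_add]; exact add_mem hp hq
  | smul c p _ hp =>
    rw [smul_eq_mul, map_mul]
    exact Submodule.smul_mem _ (Weyl.thetaHom m c) hp

theorem aeval_sub_aeval_mem {ι B : Type*} [CommRing B] [Algebra ℂ B] (I : Ideal B) {f g : ι → B}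
    (h : ∀ i, f i - g i ∈ I) (q : MvPolynomial ι ℂ) : aeval f q - aeval g q ∈ I := by
  rw [← Ideal.Quotient.eq, ← Ideal.Quotient.mkₐ_eq_mk ℂ, ← AlgHom.comp_apply, ← AlgHom.comp_apply]
  congr 1
  ext i
  simpa using Ideal.Quotient.eq.2 (h i)

/-- The restriction `q(β - s a_0)` of a polynomial `q` on `ℂ^d` to the line through `β` in the
direction of the first column. -/
def restrictLine (A : Matrix (Fin d) (Fin (n + 1)) ℤ) (β : Fin d → ℂ) :
    MvPolynomial (Fin d) ℂ →ₐ[ℂ] Polynomial ℂ :=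
  aeval fun i => Polynomial.C (β i) - Polynomial.C (A i 0 : ℂ) * Polynomial.X

theorem eval_restrictLine (A : Matrix (Fin d) (Fin (n + 1)) ℤ) (β : Fin d → ℂ) (ε : ℂ)
    (q : MvPolynomial (Fin d) ℂ) :
    (restrictLine A β q).eval ε = aeval (β - ε • toComplex (A.col 0)) q := by
  rw [restrictLine, ← Polynomial.coe_aeval_eq_eval, ← AlgHom.comp_apply]
  congr 1
  ext i
  simp [toComplex, Matrix.col, mul_comm]

theorem rename_succ_descProd (u : Fin n → ℕ) :
    rename Fin.succ (descProd u) = descProd (Fin.cons 0 u : Fin (n + 1) → ℕ) := by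
  simp [descProd, Fin.prod_univ_succ, ← Polynomial.aeval_algHom_apply]

variable (A : Matrix (Fin d) (Fin (n + 1)) ℤ) (β : Fin d → ℂ)

theorem isUpperSet_mono_mem {m : ℕ} (J : Ideal (R m)) : IsUpperSet {u | mono u ∈ J} := by
  intro u w h hu
  have e : w = (w - u) + u := (tsub_add_cancel_of_le h).symm
  rw [Set.mem_ofPred_eq, e, mono_add]
  exact J.mul_mem_left _ hu

/-- The part `∑_{j ≥ 1} a_{i,j} X_j` of the Euler operator that does not involve `θ_0`. -/
def eulerTail (i : Fin d) : MvPolynomial (Fin n) ℂ := ∑ j, (A i j.succ : ℂ) • X j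

theorem eval_aeval_eulerTail (u : Fin n → ℕ) (q : MvPolynomial (Fin d) ℂ) :
    eval (fun j => (u j : ℂ)) (aeval (eulerTail A) q) =
      aeval (toComplex (monoDegree (dropFirst A) u)) q := by
  rw [← coe_aeval_eq_eval, RingHom.coe_coe, ← AlgHom.comp_apply]
  congr 1
  ext i
  simp [eulerTail, toComplex, monoDegree_apply, dropFirst, smul_eval]

/-- Let `q` vanish on the degrees of `S_{A'} / J̄_{A,0}`. Then `q` of the tails of the Euler
operators is a combination of normally ordered monomials `x^u ∂^u` with `∂^u ∈ J_{A,0}`, and modulo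
the hypergeometric ideal it equals `q(β - θ_0 a_0)`. -/
theorem descPochhammer_mul_restrictLine_mem_bIdeal {k : ℕ}
    (hk : jIdeal A = ⨆ i ∈ Set.Icc 1 k, jLevel A i) {q : MvPolynomial (Fin d) ℂ}
    (hq : q ∈ vanishingIdeal ℂ
      (toComplex '' degrees (quotientPiece (dropFirst A) (barJ A)))) :
    descPochhammer ℂ k * restrictLine A β q ∈ bIdeal A β 0 := by
  have hG : aeval (eulerTail A) q ∈ Submodule.span ℂ (descProd '' {u | mono u ∈ jIdeal A}) := by
    refine mem_span_descProd_of_eval_eq_zero (isUpperSet_mono_mem _) _ fun u hu => ?_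
    rw [eval_aeval_eulerTail]
    exact hq _ ⟨_, mem_degrees_quotientPiece_iff.2 ⟨u, hu, rfl⟩, rfl⟩
  have h₁ : Polynomial.aeval (Weyl.theta 0) (descPochhammer ℂ k) *
      Weyl.thetaHom (n + 1) (rename Fin.succ (aeval (eulerTail A) q)) ∈
        hypergeometricAddV A β 0 := by
    generalize aeval (eulerTail A) q = G at hG
    induction hG using Submodule.span_induction with
    | mem p hp =>
      obtain ⟨u, hu, rfl⟩ := hp
      have hc : Weyl.theta 0 * Weyl.xPow (Fin.cons 0 u : Fin (n + 1) → ℕ) =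
          Weyl.xPow (Fin.cons 0 u : Fin (n + 1) → ℕ) * Weyl.theta 0 := by
        simp [Weyl.theta_mul_xPow]
      rw [rename_succ_descProd, Weyl.thetaHom_descProd, ← mul_assoc,
        Weyl.aeval_theta_mul_of_commute hc, mul_assoc, ← Weyl.delHom_mono, ← polyInclusion_mono]
      exact xPow_mul_mem_hypergeometricAddV _ (descPochhammer_mul_mem_of_mem_jIdeal β hk hu)
    | zero => simp
    | add p q _ _ hp hq => rw [map_add, map_add, mul_add]; exact add_mem hp hq
    | smul c p _ hp =>
      rw [map_smul, map_smul, mul_smul_comm]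
      exact Submodule.smul_mem _ c hp
  have h₂ : Weyl.thetaHom (n + 1) (rename Fin.succ (aeval (eulerTail A) q) -
      Polynomial.aeval (X 0) (restrictLine A β q)) ∈ hypergeometricIdeal A β := by
    refine thetaHom_mem_hypergeometricIdeal A β ?_
    rw [restrictLine, ← AlgHom.comp_apply, ← AlgHom.comp_apply, comp_aeval, comp_aeval]
    refine aeval_sub_aeval_mem _ (fun i => ?_) q
    refine Ideal.subset_span (Set.mem_range.2 ⟨i, ?_⟩)
    simp [eulerTail, Fin.sum_univ_succ, smul_eq_C_mul, algebraMap_eq]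
    ring
  have e : Polynomial.aeval (Weyl.theta 0) (descPochhammer ℂ k * restrictLine A β q) =
      Polynomial.aeval (Weyl.theta 0) (descPochhammer ℂ k) *
        Weyl.thetaHom (n + 1) (rename Fin.succ (aeval (eulerTail A) q)) -
      Polynomial.aeval (Weyl.theta 0) (descPochhammer ℂ k) *
        Weyl.thetaHom (n + 1) (rename Fin.succ (aeval (eulerTail A) q) -
          Polynomial.aeval (X 0) (restrictLine A β q)) := by
    rw [← mul_sub, ← map_sub, sub_sub_cancel, ← Polynomial.aeval_algHom_apply, Weyl.thetaHom_X,
      map_mul]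
  rw [mem_bIdeal, e]
  exact sub_mem h₁ (mem_hypergeometricAddV_of_mem_ideal (Submodule.smul_mem _ _ h₂))

/-! ### Rational dependence of the first column on the others -/

theorem exists_nat_mul_eq_intCast (c : Fin n → ℚ) :
    ∃ k : ℕ, 0 < k ∧ ∃ z : Fin n → ℤ, ∀ j, (z j : ℚ) = k * c j := by
  refine ⟨∏ j, (c j).den, Finset.prod_pos fun j _ => (c j).den_pos,
    fun j => (∏ i ∈ Finset.univ.erase j, ((c i).den : ℤ)) * (c j).num, fun j => ?_⟩
  rw [← Finset.mul_prod_erase _ _ (Finset.mem_univ j)]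
  push_cast
  rw [← Rat.mul_den_eq_num]
  ring

/-- Either the first column is rationally dependent on the columns indexed by `σ`, or some linear
form vanishes on the latter and not on the former. -/
theorem exists_relation_or_exists_form (σ : Finset (Fin n)) :
    (∃ (k : ℕ) (u w : Fin n → ℕ), 0 < k ∧ (∀ j ∉ σ, u j = 0) ∧
      k • A.col 0 + monoDegree (dropFirst A) u = monoDegree (dropFirst A) w) ∨
    ∃ l : Fin d → ℂ, (∀ j ∈ σ, ∑ i, l i * (A i j.succ : ℂ) = 0) ∧ ∑ i, l i * (A i 0 : ℂ) = 1 := by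
  let a : Fin (n + 1) → Fin d → ℚ := fun j i => A i j
  by_cases h : a 0 ∈ Submodule.span ℚ ((fun j : Fin n => a j.succ) '' (σ : Set (Fin n)))
  · left
    obtain ⟨c₀, hc₀⟩ := (Submodule.mem_span_image_finset_iff_exists_fun ℚ).1 h
    obtain ⟨c, hc⟩ : ∃ c : Fin n → ℚ, ∑ j ∈ σ, c j • a j.succ = a 0 := by
      refine ⟨fun j => if hj : j ∈ σ then c₀ ⟨j, hj⟩ else 0, ?_⟩
      rw [← hc₀, ← Finset.sum_coe_sort σ]
      simp
    obtain ⟨k, hk, z, hz⟩ := exists_nat_mul_eq_intCast c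
    refine ⟨k, fun j => if j ∈ σ then (-z j).toNat else 0,
      fun j => if j ∈ σ then (z j).toNat else 0, hk, fun j hj => by simp [hj], ?_⟩
    ext i
    have hi : (k : ℚ) * A i 0 = ∑ j, (A i j.succ : ℚ) * if j ∈ σ then (z j : ℚ) else 0 := by
      have := congrFun hc i
      simp only [Finset.sum_apply, Pi.smul_apply, smul_eq_mul, a] at this
      rw [← this, Finset.mul_sum]
      simp only [mul_ite, mul_zero, Finset.sum_ite_mem, Finset.univ_inter, hz]
      exact Finset.sum_congr rfl fun j _ => by ring
    have hi' : (k : ℤ) * A i 0 = ∑ j, A i j.succ * if j ∈ σ then z j else 0 := by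
      exact_mod_cast hi
    rw [Pi.add_apply, monoDegree_apply, monoDegree_apply, ← eq_sub_iff_add_eq,
      ← Finset.sum_sub_distrib, Pi.smul_apply, nsmul_eq_mul]
    refine hi'.trans (Finset.sum_congr rfl fun j _ => ?_)
    rw [← mul_sub]
    congr 1
    split_ifs <;> lia
  · right
    obtain ⟨f, hf, hf'⟩ := Submodule.exists_le_ker_of_notMem h
    have hs : ∀ v : Fin d → ℚ, f v = ∑ i, f (Pi.single i 1) * v i := fun v => by
      rw [LinearMap.pi_apply_eq_sum_univ f v]
      refine Finset.sum_congr rfl fun i _ => ?_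
      rw [smul_eq_mul, mul_comm]
      congr 2
      ext j
      simp [Pi.single_apply, eq_comm]
    have hs' : ∀ j, ∑ i, ((f (Pi.single i 1) / f (a 0) : ℚ) : ℂ) * (A i j : ℂ) =
        ((f (a j) / f (a 0) : ℚ) : ℂ) := fun j => by
      rw [hs (a j), Finset.sum_div]
      push_cast
      refine Finset.sum_congr rfl fun i _ => ?_
      simp only [a]
      push_cast
      ring
    refine ⟨fun i => ((f (Pi.single i 1) / f (a 0) : ℚ) : ℂ), fun j hj => ?_, ?_⟩
    · have h0 : f (a j.succ) = 0 := hf' (Submodule.subset_span ⟨j, hj, rfl⟩)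
      rw [hs', h0, zero_div, Rat.cast_zero]
    · rw [hs', div_self hf, Rat.cast_one]

theorem sum_mul_monoDegree (l : Fin d → ℂ) (u : Fin n → ℕ) :
    ∑ i, l i * (monoDegree (dropFirst A) u i : ℂ) =
      ∑ j, (∑ i, l i * (A i j.succ : ℂ)) * u j := by
  simp only [monoDegree_apply, Int.cast_sum, Finset.mul_sum, Finset.sum_mul]
  rw [Finset.sum_comm]
  refine Finset.sum_congr rfl fun j _ => Finset.sum_congr rfl fun i _ => ?_
  simp [dropFirst, mul_assoc]

/-- The line through `β` in the direction `a_0` is not contained in the quasi-degrees of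
`S_{A'} / J̄_{A,0}`. If the large entries of an exponent `u` have index set `σ` and `a_0` is
rationally dependent on the columns in `σ`, then `∂^u ∈ J_{A,0}`; otherwise a linear form takes
finitely many values on the degrees of such monomials and is not constant along `a_0`. -/
theorem exists_mem_vanishingIdeal_restrictLine_ne_zero :
    ∃ q ∈ vanishingIdeal ℂ (toComplex '' degrees (quotientPiece (dropFirst A) (barJ A))),
      restrictLine A β q ≠ 0 := by
  classical
  have h : ∀ σ : Finset (Fin n), ∃ (u : Fin n → ℕ) (l : Fin d → ℂ), (∀ j ∉ σ, u j = 0) ∧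
      (mono u ∉ jIdeal A →
        (∀ j ∈ σ, ∑ i, l i * (A i j.succ : ℂ) = 0) ∧ ∑ i, l i * (A i 0 : ℂ) = 1) := by
    intro σ
    rcases exists_relation_or_exists_form A σ with ⟨k, u, w, hk, hu, h⟩ | ⟨l, h⟩
    · exact ⟨u, 0, hu, fun hJ => absurd (jLevel_le_jIdeal hk (mono_mem_jLevel h)) hJ⟩
    · exact ⟨0, l, fun _ _ => rfl, fun _ => h⟩
  choose u l hu hl using h
  obtain ⟨N, hN⟩ : ∃ N, ∀ σ j, u σ j ≤ N :=
    ⟨∑ σ, ∑ j, u σ j, fun σ j =>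
      (Finset.single_le_sum (f := fun j => u σ j) (fun _ _ => Nat.zero_le _)
        (Finset.mem_univ j)).trans (Finset.single_le_sum (f := fun σ => ∑ j, u σ j)
          (fun _ _ => Nat.zero_le _) (Finset.mem_univ σ))⟩
  let v : (Fin n → Fin (N + 1)) → Finset (Fin n) → ℂ := fun a σ =>
    ∑ i, l σ i * (monoDegree (dropFirst A) (fun j => (a j : ℕ)) i : ℂ)
  -- one factor for each independent `σ` and each value of the form on exponents bounded by `N`
  refine ⟨∏ σ with mono (u σ) ∉ jIdeal A, ∏ a : Fin n → Fin (N + 1),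
    (∑ i, l σ i • X i - C (v a σ)), ?_, ?_⟩
  · rintro _ ⟨α, hα, rfl⟩
    obtain ⟨w, hw, rfl⟩ := mem_degrees_quotientPiece_iff.1 hα
    set σ : Finset (Fin n) := {j | N < w j}
    -- the entries of `w` in `σ` exceed those of `u σ`, so `∂^w` is a multiple of `∂^(u σ)`
    have hσ : mono (u σ) ∉ jIdeal A := by
      intro hJ
      suffices h : u σ ≤ w from hw ((isUpperSet_mono_mem (jIdeal A) h hJ : w ∈ {u | _}))
      intro j
      by_cases hj : j ∈ σ
      · exact (hN σ j).trans (Finset.mem_filter.1 hj).2.le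
      · rw [hu σ j hj]
        exact Nat.zero_le _
    rw [map_prod]
    refine Finset.prod_eq_zero (Finset.mem_filter.2 ⟨Finset.mem_univ σ, hσ⟩) ?_
    rw [map_prod]
    refine Finset.prod_eq_zero
      (Finset.mem_univ fun j => if h : N < w j then 0 else ⟨w j, by lia⟩) ?_
    simp only [map_sub, map_sum, map_smul, aeval_X, aeval_C, toComplex, smul_eq_mul, v,
      Algebra.algebraMap_self, RingHom.id_apply]
    rw [sum_mul_monoDegree, sum_mul_monoDegree, ← Finset.sum_sub_distrib]
    refine Finset.sum_eq_zero fun j _ => ?_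
    by_cases hj : N < w j
    · rw [(hl σ hσ).1 j (Finset.mem_filter.2 ⟨Finset.mem_univ j, hj⟩)]
      simp
    · simp [hj]
  · rw [map_prod, Finset.prod_ne_zero_iff]
    intro σ hσ
    rw [map_prod, Finset.prod_ne_zero_iff]
    rintro a - h0
    have h1 := (hl σ (Finset.mem_filter.1 hσ).2).2
    -- the restriction of the linear form to the line has slope `-1`
    have h2 := congrArg (fun p => p.eval 0 - p.eval 1) h0
    rw [eval_restrictLine, eval_restrictLine] at h2
    simp only [Polynomial.eval_zero, map_sub, map_sum, map_smul, aeval_X,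
      aeval_C, smul_eq_mul, Pi.sub_apply, Pi.smul_apply, toComplex, Matrix.col, Matrix.transpose_apply,
      zero_mul, one_mul, sub_zero, sub_sub_sub_cancel_right, ← Finset.sum_sub_distrib, ← mul_sub,
      sub_sub_cancel] at h2
    rw [h1] at h2
    exact one_ne_zero h2

theorem bIdeal_ne_bot : bIdeal A β 0 ≠ ⊥ := by
  obtain ⟨k, hk⟩ := exists_jIdeal_eq_iSup A
  obtain ⟨q, hq, h0⟩ := exists_mem_vanishingIdeal_restrictLine_ne_zero A β
  intro h
  have := descPochhammer_mul_restrictLine_mem_bIdeal A β hk hq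
  rw [h, Ideal.mem_bot] at this
  exact mul_ne_zero (monic_descPochhammer ℂ k).ne_zero h0 this

variable {A β}

theorem exists_eq_natCast_of_isRoot_descPochhammer {k : ℕ} {ε : ℂ}
    (h : (descPochhammer ℂ k).IsRoot ε) : ∃ i < k, ε = (i : ℂ) := by
  rw [Polynomial.IsRoot, descPochhammer_eval_eq_prod_range, Finset.prod_eq_zero_iff] at h
  obtain ⟨i, hi, h⟩ := h
  exact ⟨i, Finset.mem_range.1 hi, sub_eq_zero.1 h⟩

theorem isRoot_mem_lineIntersection_or {b : Polynomial ℂ} (hb : IsHypergeometricBFunction A β 0 b)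
    {k : ℕ} (hk : jIdeal A = ⨆ i ∈ Set.Icc 1 k, jLevel A i) {ε : ℂ} (hε : b.IsRoot ε) :
    ε • toComplex (A.col 0) ∈
        lineIntersection (quasiDegrees (quotientPiece (dropFirst A) (barJ A))) β
          (toComplex (A.col 0)) ∨
      ∃ i < k, ε = (i : ℂ) := by
  by_cases h : (descPochhammer ℂ k).IsRoot ε
  · exact Or.inr (exists_eq_natCast_of_isRoot_descPochhammer h)
  · refine Or.inl ⟨⟨β - ε • toComplex (A.col 0), fun q hq => ?_, by abel⟩, ε, rfl⟩
    have h₁ := hε.dvd (hb.dvd (descPochhammer_mul_restrictLine_mem_bIdeal A β hk hq))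
    rw [Polynomial.IsRoot, Polynomial.eval_mul, mul_eq_zero, eval_restrictLine] at h₁
    exact h₁.resolve_left h

end GKZ

namespace GKZ

variable {d m n : ℕ}

/-! ### Rational points of cones -/

/-- A rational system of linear equations with a nonnegative real solution has a nonnegative
rational one. If a real solution `c` differs from its image under a `ℚ`-linear retraction of `ℝ`
onto `ℚ`, moving along the difference produces a nonnegative solution with smaller support. -/
theorem exists_rat_nonneg_of_real_nonneg (a : Fin d → Fin n → ℚ) (b : Fin d → ℚ) (c : Fin n → ℝ)
    (hc : ∀ j, 0 ≤ c j) (h : ∀ i, (b i : ℝ) = ∑ j, c j * (a i j : ℝ)) :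
    ∃ q : Fin n → ℚ, (∀ j, 0 ≤ q j) ∧ ∀ i, b i = ∑ j, q j * a i j := by
  classical
  obtain ⟨f, hf⟩ := LinearMap.exists_leftInverse_of_injective (LinearMap.toSpanSingleton ℚ ℝ 1)
    (LinearMap.ker_toSpanSingleton ℚ one_ne_zero)
  have hf1 : ∀ q : ℚ, f q = q := fun q => by
    have := LinearMap.congr_fun hf q
    simpa [Rat.smul_def] using this
  generalize hs : ({j | c j ≠ 0} : Finset (Fin n)) = s
  induction s using Finset.strongInduction generalizing c with
  | H s ih =>
    have hfc : ∀ i, b i = ∑ j, f (c j) * a i j := fun i => by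
      rw [← hf1 (b i), h i, map_sum]
      refine Finset.sum_congr rfl fun j _ => ?_
      rw [mul_comm, ← Rat.smul_def, map_smul, smul_eq_mul, mul_comm]
    by_cases hq : ∀ j, c j = f (c j)
    · refine ⟨fun j => f (c j), fun j => ?_, hfc⟩
      have := hc j
      rw [hq j] at this
      exact_mod_cast this
    · obtain ⟨z, hz, hz0, hzp⟩ : ∃ z : Fin n → ℝ, (∀ i, ∑ j, z j * (a i j : ℝ) = 0) ∧
          (∀ j, c j = 0 → z j = 0) ∧ ∃ j, 0 < z j := by
        obtain ⟨j, hj⟩ := not_forall.1 hq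
        have hg : ∀ i, ∑ j, (c j - f (c j)) * (a i j : ℝ) = 0 := fun i => by
          simp only [sub_mul, Finset.sum_sub_distrib]
          rw [← h i, hfc i]
          push_cast
          exact sub_self _
        rcases lt_or_gt_of_ne (sub_ne_zero.2 hj) with hlt | hgt
        · refine ⟨fun j => -(c j - f (c j)), fun i => ?_, fun j hj => by simp [hj], j, by simpa using hlt⟩
          simp only [neg_mul, Finset.sum_neg_distrib, hg, neg_zero]
        · exact ⟨fun j => c j - f (c j), hg, fun j hj => by simp [hj], j, hgt⟩
      obtain ⟨j₀, hj₀, hmin⟩ := Finset.exists_min_image ({j | 0 < z j} : Finset (Fin n))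
        (fun j => c j / z j) (hzp.imp fun j hj => Finset.mem_filter.2 ⟨Finset.mem_univ j, hj⟩)
      have hz₀ : 0 < z j₀ := (Finset.mem_filter.1 hj₀).2
      refine ih ({j | c j - c j₀ / z j₀ * z j ≠ 0} : Finset (Fin n)) ?_
        (fun j => c j - c j₀ / z j₀ * z j) (fun j => ?_) (fun i => ?_) rfl
      · rw [← hs, Finset.ssubset_iff_of_subset]
        · refine ⟨j₀, ?_, ?_⟩
          · simpa using fun h => hz₀.ne' (hz0 j₀ h)
          · simp [div_mul_cancel₀ _ hz₀.ne']
        · intro j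
          simp only [Finset.mem_filter, Finset.mem_univ, true_and]
          contrapose!
          intro hj
          simp [hj, hz0 j hj]
      · rw [sub_nonneg]
        rcases le_or_gt (z j) 0 with hj | hj
        · exact (mul_nonpos_of_nonneg_of_nonpos (div_nonneg (hc _) hz₀.le) hj).trans (hc j)
        · exact (le_div_iff₀ hj).1 (hmin j (Finset.mem_filter.2 ⟨Finset.mem_univ j, hj⟩))
      · simp only [sub_mul, Finset.sum_sub_distrib, mul_assoc, ← Finset.mul_sum, hz, mul_zero, sub_zero]
        exact h i

theorem mem_closure_range_col_iff (A : Matrix (Fin d) (Fin n) ℤ) {α : Fin d → ℤ} :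
    α ∈ AddSubmonoid.closure (Set.range A.col) ↔ ∃ u, monoDegree A u = α := by
  have e : ∀ u, monoDegree A u = ∑ j, u j • A.col j := fun u => by
    ext i
    simp [monoDegree_apply, Matrix.col, mul_comm]
  constructor
  · intro h
    induction h using AddSubmonoid.closure_induction with
    | mem α h =>
      obtain ⟨j, rfl⟩ := h
      refine ⟨Pi.single j 1, ?_⟩
      rw [e, Finset.sum_eq_single j] <;> simp +contextual
    | zero => exact ⟨0, by simp [e]⟩
    | add α α' _ _ h h' =>
      obtain ⟨u, rfl⟩ := h
      obtain ⟨u', rfl⟩ := h'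
      exact ⟨u + u', monoDegree_add _ _ _⟩
  · rintro ⟨u, rfl⟩
    rw [e]
    exact sum_mem fun j _ =>
      nsmul_mem (AddSubmonoid.subset_closure (Set.mem_range_self (f := A.col) j)) _

variable {A : Matrix (Fin d) (Fin (n + 1)) ℤ} {β : Fin d → ℂ}

theorem exists_nsmul_col_eq_monoDegree {c : Fin n → ℝ} (hc : ∀ j, 0 ≤ c j)
    (h : ∀ i, (A i 0 : ℝ) = ∑ j, c j * (dropFirst A i j : ℝ)) :
    ∃ k : ℕ, 0 < k ∧ ∃ u, monoDegree (dropFirst A) u = k • A.col 0 := by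
  obtain ⟨q, hq, hq'⟩ := exists_rat_nonneg_of_real_nonneg (fun i j => (dropFirst A i j : ℚ))
    (fun i => (A i 0 : ℚ)) c hc (by simpa using h)
  obtain ⟨k, hk, z, hz⟩ := exists_nat_mul_eq_intCast q
  refine ⟨k, hk, fun j => (z j).toNat, ?_⟩
  ext i
  have hz0 : ∀ j, ((z j).toNat : ℤ) = z j := fun j => by
    refine Int.toNat_of_nonneg ?_
    have : (0 : ℚ) ≤ z j := by
      rw [hz]
      exact mul_nonneg (Nat.cast_nonneg _) (hq j)
    exact_mod_cast this
  have e : ((∑ j, dropFirst A i j * z j : ℤ) : ℚ) = ((k * A i 0 : ℤ) : ℚ) := by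
    push_cast
    rw [hq' i, Finset.mul_sum]
    refine Finset.sum_congr rfl fun j _ => ?_
    rw [hz]
    ring
  simp only [monoDegree_apply, hz0]
  rw [Int.cast_inj.1 e]
  simp [Matrix.col]

/-- If `k a_0 ∈ ℕ A'`, then `∂_0^k ∈ S_{A'}` and the unit ideal is the `k`-th of the ideals
`J_{A,0;i}`. -/
theorem descPochhammer_mem_bIdeal {k : ℕ} (hk : 0 < k) {u : Fin n → ℕ}
    (h : monoDegree (dropFirst A) u = k • A.col 0) : descPochhammer ℂ k ∈ bIdeal A β 0 := by
  have h1 : (1 : R n) ∈ jLevel A k := by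
    rw [← mono_zero]
    refine mono_mem_jLevel (w := u) ?_
    rw [h]
    ext i
    simp [monoDegree_apply]
  simpa [mem_bIdeal] using descPochhammer_mul_mem_of_mem_jLevel β hk h1

theorem exists_isLeast_and_roots {b : Polynomial ℂ} (hb : IsHypergeometricBFunction A β 0 b)
    {c : Fin n → ℝ} (hc : ∀ j, 0 ≤ c j)
    (h : ∀ i, (A i 0 : ℝ) = ∑ j, c j * (dropFirst A i j : ℝ)) :
    ∃ k : ℕ,
      IsLeast {t : ℕ | 0 < t ∧
        t • A.col 0 ∈ AddSubmonoid.closure (Set.range (dropFirst A).col)} k ∧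
      ∀ ε : ℂ, b.IsRoot ε → ∃ i < k, ε = (i : ℂ) := by
  classical
  obtain ⟨k, hk, hu⟩ := exists_nsmul_col_eq_monoDegree hc h
  have hex : ∃ t : ℕ, 0 < t ∧
      t • A.col 0 ∈ AddSubmonoid.closure (Set.range (dropFirst A).col) :=
    ⟨k, hk, (mem_closure_range_col_iff _).2 hu⟩
  refine ⟨Nat.find hex, ⟨Nat.find_spec hex, fun t ht => Nat.find_min' hex ht⟩, fun ε hε => ?_⟩
  obtain ⟨hpos, hmem⟩ := Nat.find_spec hex
  obtain ⟨u, hu⟩ := (mem_closure_range_col_iff _).1 hmem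
  exact exists_eq_natCast_of_isRoot_descPochhammer
    (hε.dvd (hb.dvd (descPochhammer_mem_bIdeal hpos hu)))

end GKZ

/-! ### Krull dimension and transcendence degree -/

/-- Going up lifts chains of primes, and incomparability makes contraction strictly monotone. -/
theorem ringKrullDim_eq_of_isIntegral (B C : Type*) [CommRing B] [CommRing C] [Algebra B C]
    [FaithfulSMul B C] [Algebra.IsIntegral B C] : ringKrullDim B = ringKrullDim C := by
  refine le_antisymm (iSup_le fun l => ?_) ?_
  · obtain ⟨⟨P, hP, hPl⟩⟩ : Nonempty (Ideal.primesOver l.head.asIdeal C) := inferInstance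
    obtain ⟨L, hL, -⟩ := Ideal.exists_ltSeries_of_hasGoingUp l P
    rw [← hL]
    exact Order.LTSeries.length_le_krullDim L
  · exact Order.krullDim_le_of_strictMono (PrimeSpectrum.comap (algebraMap B C)) fun P Q hPQ =>
      Ideal.IsIntegral.comap_lt_comap (I := P.asIdeal) (J := Q.asIdeal) hPQ

/-- The Krull dimension of a finitely generated domain over `ℂ` is its transcendence degree, by
Noether normalization. -/
theorem exists_ringKrullDim_eq_and_trdeg_eq (B : Type) [CommRing B] [IsDomain B] [Algebra ℂ B]
    [Algebra.FiniteType ℂ B] :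
    ∃ s : ℕ, ringKrullDim B = s ∧ Algebra.trdeg ℂ B = s := by
  obtain ⟨s, g, hg, hint⟩ := exists_integral_inj_algHom_of_fg ℂ B
  let _ : Algebra (MvPolynomial (Fin s) ℂ) B := g.toRingHom.toAlgebra
  have : IsScalarTower ℂ (MvPolynomial (Fin s) ℂ) B :=
    IsScalarTower.of_algebraMap_eq fun a => (g.commutes a).symm
  have : FaithfulSMul (MvPolynomial (Fin s) ℂ) B := (faithfulSMul_iff_algebraMap_injective _ _).2 hg
  have : Algebra.IsIntegral (MvPolynomial (Fin s) ℂ) B := ⟨hint⟩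
  refine ⟨s, ?_, ?_⟩
  · rw [← ringKrullDim_eq_of_isIntegral (MvPolynomial (Fin s) ℂ) B,
      MvPolynomial.ringKrullDim_of_isNoetherianRing, ringKrullDim_eq_zero_of_field, zero_add,
      Nat.card_fin]
  · rw [← trdeg_add_eq ℂ (MvPolynomial (Fin s) ℂ),
      trdeg_eq_zero (R := MvPolynomial (Fin s) ℂ), add_zero, MvPolynomial.trdeg_of_isDomain]
    simp

namespace GKZ

variable {d m n : ℕ}

/-! ### Toric rings as semigroup rings -/

/-- The homomorphism `∂^u ↦ t^{A u}` from `R_A` to the Laurent polynomials. -/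
def toLaurent (A : Matrix (Fin d) (Fin m) ℤ) : R m →ₐ[ℂ] AddMonoidAlgebra ℂ (Fin d → ℤ) :=
  aeval fun j => AddMonoidAlgebra.single (A.col j) 1

theorem toLaurent_mono (A : Matrix (Fin d) (Fin m) ℤ) (u : Fin m → ℕ) :
    toLaurent A (mono u) = AddMonoidAlgebra.single (monoDegree A u) 1 := by
  have e : ∀ s : Finset (Fin m), toLaurent A (∏ j ∈ s, X j ^ u j) =
      AddMonoidAlgebra.single (∑ j ∈ s, u j • A.col j) 1 := by
    intro s
    induction s using Finset.induction_on with
    | empty => rw [Finset.prod_empty, Finset.sum_empty, map_one, AddMonoidAlgebra.one_def]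
    | insert a s ha ih =>
      rw [Finset.prod_insert ha, Finset.sum_insert ha, map_mul, ih, map_pow, toLaurent, aeval_X,
        AddMonoidAlgebra.single_pow, AddMonoidAlgebra.single_mul_single, one_pow, one_mul]
  rw [mono, e]
  congr 1
  ext i
  simp [monoDegree_apply, Matrix.col, mul_comm]

/-- The toric ideal is the kernel of the map to the Laurent polynomials. -/
theorem toLaurent_eq_zero_iff (A : Matrix (Fin d) (Fin m) ℤ) {p : R m} :
    toLaurent A p = 0 ↔ p ∈ toricIdeal A := by
  classical
  constructor
  · intro h
    -- a linear section over the monomials in the image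
    let c : (Fin d → ℤ) → S A := fun α =>
      if h : ∃ u, monoDegree A u = α then Ideal.Quotient.mk _ (mono h.choose) else 0
    let g : AddMonoidAlgebra ℂ (Fin d → ℤ) →ₗ[ℂ] S A :=
      (Finsupp.linearCombination ℂ c).comp (AddMonoidAlgebra.coeffLinearEquiv ℂ).toLinearMap
    have hg : g.comp (toLaurent A).toLinearMap =
        (Ideal.Quotient.mkₐ ℂ (toricIdeal A)).toLinearMap := by
      refine LinearMap.ext_on_range (span_range_mono m) fun u => ?_
      have hu : ∃ w, monoDegree A w = monoDegree A u := ⟨u, rfl⟩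
      have h1 : g (toLaurent A (mono u)) = c (monoDegree A u) := by
        rw [toLaurent_mono]
        simp [g]
      change g (toLaurent A (mono u)) = Ideal.Quotient.mk _ (mono u)
      rw [h1]
      simp only [c, dif_pos hu]
      exact Ideal.Quotient.eq.2 (mono_sub_mono_mem_toricIdeal hu.choose_spec)
    have h2 := LinearMap.congr_fun hg p
    rw [← Ideal.Quotient.eq_zero_iff_mem]
    change g (toLaurent A p) = Ideal.Quotient.mk _ p at h2
    rw [← h2, h, map_zero]
  · intro h
    rw [toricIdeal] at h
    induction h using Submodule.span_induction with
    | mem p hp =>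
      obtain ⟨v, hv, rfl⟩ := hp
      rw [map_sub, toLaurent_mono, toLaurent_mono, sub_eq_zero]
      congr 1
      rw [← sub_eq_zero, monoDegree, monoDegree, ← Matrix.mulVec_sub, ← hv]
      congr 1
      ext j
      simp only [posPart, negPart, Pi.sub_apply]
      lia
    | zero => simp
    | add p q _ _ hp hq => rw [map_add, hp, hq, add_zero]
    | smul c p _ hp => rw [smul_eq_mul, map_mul, hp, mul_zero]

theorem mk_mono_ne_zero (A : Matrix (Fin d) (Fin m) ℤ) (u : Fin m → ℕ) :
    (Ideal.Quotient.mk (toricIdeal A) (mono u) : S A) ≠ 0 := by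
  rw [Ne, Ideal.Quotient.eq_zero_iff_mem, ← toLaurent_eq_zero_iff, toLaurent_mono]
  simp

instance isDomain_toricRing (A : Matrix (Fin d) (Fin m) ℤ) : IsDomain (S A) := by
  have e : toricIdeal A = RingHom.ker (toLaurent A) := by
    ext p
    rw [RingHom.mem_ker, toLaurent_eq_zero_iff]
  rw [Ideal.Quotient.isDomain_iff_prime, e]
  exact RingHom.ker_isPrime _

theorem toricInclusion_injective (A : Matrix (Fin d) (Fin (n + 1)) ℤ) :
    Function.Injective (toricInclusion A) := by
  rw [injective_iff_map_eq_zero]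
  intro p hp
  obtain ⟨p, rfl⟩ := Ideal.Quotient.mk_surjective p
  rw [toricInclusion_mk, Ideal.Quotient.eq_zero_iff_mem, ← toLaurent_eq_zero_iff] at hp
  have e : (toLaurent A).comp (polyInclusion n) = toLaurent (dropFirst A) := by
    ext j : 1
    simp [toLaurent, polyInclusion, dropFirst, Matrix.col]
    rfl
  rw [Ideal.Quotient.eq_zero_iff_mem, ← toLaurent_eq_zero_iff, ← e]
  exact hp

theorem toricInclusion_algebraMap (A : Matrix (Fin d) (Fin (n + 1)) ℤ) (a : ℂ) :
    toricInclusion A (algebraMap ℂ _ a) = algebraMap ℂ _ a := by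
  change toricInclusion A (Ideal.Quotient.mk _ (C a)) = Ideal.Quotient.mk _ (C a)
  rw [toricInclusion_mk, polyInclusion, rename_C]

/-- If `a_0` is rationally dependent on the other columns, then `S_A` is algebraic over `S_{A'}`,
and the two rings have the same dimension. -/
theorem ringKrullDim_toricRing_eq {A : Matrix (Fin d) (Fin (n + 1)) ℤ} {k : ℕ} (hk : 0 < k)
    {u w : Fin n → ℕ}
    (h : k • A.col 0 + monoDegree (dropFirst A) u = monoDegree (dropFirst A) w) :
    ∃ s : ℕ, ringKrullDim (S A) = s ∧ ringKrullDim (S (dropFirst A)) = s := by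
  let _ : Algebra (S (dropFirst A)) (S A) := (toricInclusion A).toAlgebra
  have : IsScalarTower ℂ (S (dropFirst A)) (S A) :=
    IsScalarTower.of_algebraMap_eq fun a => (toricInclusion_algebraMap A a).symm
  have : FaithfulSMul (S (dropFirst A)) (S A) :=
    (faithfulSMul_iff_algebraMap_injective _ _).2 (toricInclusion_injective A)
  have h0 : IsAlgebraic (S (dropFirst A)) (Ideal.Quotient.mk (toricIdeal A) (X 0)) := by
    refine ⟨Polynomial.C (Ideal.Quotient.mk _ (mono u)) * Polynomial.X ^ k -
      Polynomial.C (Ideal.Quotient.mk _ (mono w)), fun h0 => ?_, ?_⟩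
    · have := congrArg (fun p => p.coeff k) h0
      simp only [Polynomial.coeff_sub, Polynomial.coeff_C_mul_X_pow, Polynomial.coeff_C,
        if_neg hk.ne', if_true, sub_zero, Polynomial.coeff_zero] at this
      exact mk_mono_ne_zero _ _ this
    · rw [map_sub, map_mul, map_pow, Polynomial.aeval_X, Polynomial.aeval_C, Polynomial.aeval_C,
        sub_eq_zero]
      change toricInclusion A _ * _ = toricInclusion A _
      rw [toricInclusion_mk, toricInclusion_mk, ← map_pow, ← map_mul, Ideal.Quotient.eq,
        mul_comm, ← mono_cons, polyInclusion_mono]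
      refine mono_sub_mono_mem_toricIdeal ?_
      rw [monoDegree_cons, monoDegree_cons, h, zero_smul, zero_add]
  have halg : Algebra.IsAlgebraic (S (dropFirst A)) (S A) := by
    refine ⟨fun p => ?_⟩
    obtain ⟨p, rfl⟩ := Ideal.Quotient.mk_surjective p
    induction p using MvPolynomial.induction_on with
    | C a =>
      change IsAlgebraic _ (algebraMap ℂ (S A) a)
      rw [← toricInclusion_algebraMap]
      exact isAlgebraic_algebraMap _
    | add p q hp hq => rw [map_add]; exact hp.add hq
    | mul_X p j hp =>
      rw [map_mul]
      refine hp.mul ?_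
      cases j using Fin.cases with
      | zero => exact h0
      | succ j =>
        have e : Ideal.Quotient.mk (toricIdeal A) (X j.succ) =
            toricInclusion A (Ideal.Quotient.mk _ (X j)) := by
          rw [toricInclusion_mk, polyInclusion, rename_X]
        rw [e]
        exact isAlgebraic_algebraMap _
  obtain ⟨s, hs, hs'⟩ := exists_ringKrullDim_eq_and_trdeg_eq (S A)
  obtain ⟨t, ht, ht'⟩ := exists_ringKrullDim_eq_and_trdeg_eq (S (dropFirst A))
  rw [← trdeg_add_eq ℂ (S (dropFirst A)), trdeg_eq_zero (R := S (dropFirst A)),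
    add_zero, ht', Nat.cast_inj] at hs'
  exact ⟨s, hs, hs' ▸ ht⟩

end GKZ

/-! ### A representation of the Weyl algebra on functions -/

namespace Weyl

variable {m : ℕ}

/-- Translation of functions on `ℂ^m` by `v`. -/
def shift (v : Fin m → ℂ) : Module.End ℂ ((Fin m → ℂ) → ℂ) where
  toFun F w := F (w + v)
  map_add' _ _ := rfl
  map_smul' _ _ := rfl

/-- The operator `F ↦ (w ↦ w_j F(w - e_j))`. -/
def mulShift (j : Fin m) : Module.End ℂ ((Fin m → ℂ) → ℂ) where
  toFun F w := w j * F (w - Pi.single j 1)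
  map_add' _ _ := by ext; simp [mul_add]
  map_smul' _ _ := by ext; simp [mul_left_comm]

/-- The representation of the Weyl algebra on functions `F` on `ℂ^m`, to be read as formal sums
`∑_w F(w) x^w / Γ(w + 1)`: the operator `∂_j` is a shift and `x_j` is `F ↦ (w ↦ w_j F(w - e_j))`.
No poles of the Gamma function intervene. -/
def rep (m : ℕ) : Weyl m →ₐ[ℂ] Module.End ℂ ((Fin m → ℂ) → ℂ) :=
  RingQuot.liftAlgHom ℂ ⟨FreeAlgebra.lift ℂ (Sum.elim mulShift fun j => shift (Pi.single j 1)), by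
    rintro _ _ (⟨i, j⟩ | ⟨i, j⟩ | ⟨i, j⟩)
    · ext F w
      rcases eq_or_ne i j with rfl | h
      · rfl
      · simp [mulShift, h, h.symm, sub_right_comm, mul_left_comm]
    · ext F w
      simp [shift, add_right_comm]
    · ext F w
      rcases eq_or_ne i j with rfl | h
      · simp [mulShift, shift, add_mul]
      · simp [mulShift, shift, h, h.symm, add_sub_right_comm]⟩

theorem rep_x (j : Fin m) : rep m (x j) = mulShift j := by
  rw [rep, x, RingQuot.liftAlgHom_mkAlgHom_apply, FreeAlgebra.lift_ι_apply, Sum.elim_inl]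

theorem rep_del (j : Fin m) : rep m (del j) = shift (Pi.single j 1) := by
  rw [rep, del, RingQuot.liftAlgHom_mkAlgHom_apply, FreeAlgebra.lift_ι_apply, Sum.elim_inr]

theorem rep_theta_apply (j : Fin m) (F : (Fin m → ℂ) → ℂ) (w : Fin m → ℂ) :
    rep m (theta j) F w = w j * F w := by
  rw [theta, map_mul, rep_x, rep_del]
  simp [mulShift, shift]

theorem shift_pow (v : Fin m → ℂ) (k : ℕ) : shift v ^ k = shift ((k : ℂ) • v) := by
  induction k with
  | zero => ext F w; simp [shift]
  | succ k ih =>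
    rw [pow_succ, ih]
    ext F w
    simp [shift, add_smul, add_assoc]

theorem rep_delPow (u : Fin m → ℕ) : rep m (delPow u) = shift fun j => (u j : ℂ) := by
  have e : ∀ s : Finset (Fin m), rep m (delHom m (∏ j ∈ s, X j ^ u j)) =
      shift (∑ j ∈ s, (u j : ℂ) • Pi.single j 1) := by
    intro s
    induction s using Finset.induction_on with
    | empty => ext F w; simp [shift]
    | insert a s ha ih =>
      rw [Finset.prod_insert ha, map_mul, map_mul, ih, Finset.sum_insert ha, map_pow, map_pow,
        delHom_X, rep_del, shift_pow]
      ext F w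
      simp [shift, add_assoc]
  rw [← delHom_mono, GKZ.mono, e]
  congr 1
  ext i
  simp [Pi.single_apply]

/-- The functions supported on the hyperplane `w_t = c`. -/
def supportedAt (t : Fin m) (c : ℂ) : Submodule ℂ ((Fin m → ℂ) → ℂ) where
  carrier := {F | ∀ w, w t ≠ c → F w = 0}
  zero_mem' _ _ := rfl
  add_mem' hF hG w hw := by rw [Pi.add_apply, hF w hw, hG w hw, add_zero]
  smul_mem' a F hF w hw := by rw [Pi.smul_apply, hF w hw, smul_zero]

theorem rep_x_mem_supportedAt (t j : Fin m) {c : ℂ} {F : (Fin m → ℂ) → ℂ}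
    (hF : F ∈ supportedAt t c) :
    rep m (x j) F ∈ supportedAt t (c + if j = t then 1 else 0) := by
  intro w hw
  rw [rep_x]
  change w j * F (w - Pi.single j 1) = 0
  rw [hF, mul_zero]
  intro h
  apply hw
  rw [← h]
  rcases eq_or_ne j t with rfl | h
  · simp
  · simp [h, h.symm]

theorem rep_xPow_mem_supportedAt (t : Fin m) (u : Fin m → ℕ) {c : ℂ} {F : (Fin m → ℂ) → ℂ}
    (hF : F ∈ supportedAt t c) : rep m (xPow u) F ∈ supportedAt t (c + u t) := by
  have hk : ∀ (j : Fin m) (k : ℕ) (c : ℂ) (F : (Fin m → ℂ) → ℂ), F ∈ supportedAt t c →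
      rep m (x j ^ k) F ∈ supportedAt t (c + if j = t then (k : ℂ) else 0) := by
    intro j k
    induction k with
    | zero => intro c F hF; simpa using hF
    | succ k ih =>
      intro c F hF
      rw [pow_succ, map_mul, Module.End.mul_apply]
      convert! ih _ _ (rep_x_mem_supportedAt t j hF) using 2
      rw [add_assoc]
      congr 1
      split_ifs <;> push_cast <;> ring
  have e : ∀ s : Finset (Fin m), rep m (xHom m (∏ j ∈ s, X j ^ u j)) F ∈
      supportedAt t (c + if t ∈ s then (u t : ℂ) else 0) := by
    intro s
    induction s using Finset.induction_on with
    | empty => simpa using hF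
    | insert a s ha ih =>
      rw [Finset.prod_insert ha, map_mul, map_mul, map_pow, xHom_X, Module.End.mul_apply]
      convert! hk a (u a) _ _ ih using 2
      rcases eq_or_ne a t with rfl | h
      · simp [ha]
      · simp [h, h.symm]
  simpa [← xHom_mono, GKZ.mono] using e Finset.univ

/-- Operators in `V^1 D` move functions supported on a hyperplane `w_t = c` off it. -/
theorem rep_apply_eq_zero_of_mem_V {t : Fin m} {c : ℂ} {F : (Fin m → ℂ) → ℂ}
    (hF : F ∈ supportedAt t c) {P : Weyl m} (hP : P ∈ V t 1) {w : Fin m → ℂ} (hw : w t = c) :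
    rep m P F w = 0 := by
  induction hP using Submodule.span_induction with
  | mem P hP =>
    obtain ⟨α, γ, h, rfl⟩ := hP
    have h1 : rep m (delPow γ) F ∈ supportedAt t (c - γ t) := by
      intro w hw
      rw [rep_delPow]
      refine hF _ fun h => hw ?_
      rw [← h]
      simp
    rw [map_mul]
    refine rep_xPow_mem_supportedAt t α h1 w fun h' => ?_
    rw [hw] at h'
    have h2 : ((α t : ℤ) : ℂ) = ((γ t : ℤ) : ℂ) := by
      push_cast
      linear_combination -h'
    have h3 := Int.cast_inj.1 h2
    lia
  | zero => simp
  | add P Q _ _ hP hQ => rw [map_add, LinearMap.add_apply, Pi.add_apply, hP, hQ, add_zero]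
  | smul a P _ hP => rw [map_smul, LinearMap.smul_apply, Pi.smul_apply, hP, smul_zero]

end Weyl

namespace GKZ

variable {d m n : ℕ}

/-- The indicator function of `{w | A w = β}`. -/
def fiberIndicator (A : Matrix (Fin d) (Fin m) ℤ) (β : Fin d → ℂ) : (Fin m → ℂ) → ℂ :=
  Set.indicator {w | ∀ i, ∑ j, (A i j : ℂ) * w j = β i} 1

/-- The indicator function of the fiber over `β` is a solution of the hypergeometric system. -/
theorem rep_fiberIndicator_eq_zero (A : Matrix (Fin d) (Fin m) ℤ) (β : Fin d → ℂ) {P : Weyl m}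
    (hP : P ∈ hypergeometricIdeal A β) : Weyl.rep m P (fiberIndicator A β) = 0 := by
  rw [hypergeometricIdeal] at hP
  induction hP using Submodule.span_induction with
  | mem P hP =>
    rcases hP with ⟨i, rfl⟩ | ⟨v, hv, rfl⟩
    · ext w
      have h : Weyl.rep m (euler A i) (fiberIndicator A β) w =
          (∑ j, (A i j : ℂ) * w j) * fiberIndicator A β w := by
        change Weyl.rep m (∑ j, (A i j : ℂ) • Weyl.theta j) (fiberIndicator A β) w = _
        simp [LinearMap.sum_apply, Weyl.rep_theta_apply, Finset.sum_mul, mul_assoc]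
      rw [map_sub, LinearMap.sub_apply, Pi.sub_apply, h, AlgHom.commutes, Module.algebraMap_end_apply,
        Pi.smul_apply, smul_eq_mul, ← sub_mul, Pi.zero_apply, mul_eq_zero]
      by_cases hw : w ∈ {w : Fin m → ℂ | ∀ i, ∑ j, (A i j : ℂ) * w j = β i}
      · exact Or.inl (sub_eq_zero.2 (hw i))
      · exact Or.inr (Set.indicator_of_notMem hw _)
    · rw [map_sub, Weyl.rep_delPow, Weyl.rep_delPow, LinearMap.sub_apply, sub_eq_zero]
      ext w
      have e : ∀ i, ∑ j, (A i j : ℂ) * (posPart v j : ℂ) = ∑ j, (A i j : ℂ) * (negPart v j : ℂ) := by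
        intro i
        have h : ∑ j, A i j * v j = 0 := congrFun hv i
        rw [← sub_eq_zero, ← Finset.sum_sub_distrib, ← Int.cast_zero, ← h, Int.cast_sum]
        refine Finset.sum_congr rfl fun j _ => ?_
        have hj : v j = (posPart v j : ℤ) - negPart v j := by
          simp only [posPart, negPart]; lia
        rw [hj]
        push_cast
        ring
      change fiberIndicator A β (w + _) = fiberIndicator A β (w + _)
      simp only [fiberIndicator, Set.indicator, Set.mem_ofPred_eq, Pi.add_apply, mul_add,
        Finset.sum_add_distrib, e, Pi.one_apply]
  | zero => simp
  | add P Q _ _ hP hQ => rw [map_add, LinearMap.add_apply, hP, hQ, add_zero]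
  | smul a P _ hP => rw [smul_eq_mul, map_mul, Module.End.mul_apply, hP, map_zero]

/-- If the columns generate `ℤ^d`, then `A : ℂ^m → ℂ^d` is surjective. -/
theorem exists_sum_mul_eq {A : Matrix (Fin d) (Fin m) ℤ}
    (hA : AddSubgroup.closure (Set.range A.col) = ⊤) (β : Fin d → ℂ) :
    ∃ w : Fin m → ℂ, ∀ i, ∑ j, (A i j : ℂ) * w j = β i := by
  let p : Submodule ℂ (Fin d → ℂ) := Submodule.span ℂ (Set.range fun j => toComplex (A.col j))
  have h : ∀ α : Fin d → ℤ, toComplex α ∈ p := by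
    intro α
    have hα : α ∈ AddSubgroup.closure (Set.range A.col) := hA ▸ AddSubgroup.mem_top α
    induction hα using AddSubgroup.closure_induction with
    | mem α h =>
      obtain ⟨j, rfl⟩ := h
      exact Submodule.subset_span ⟨j, rfl⟩
    | zero =>
      convert! p.zero_mem
      ext i; simp [toComplex]
    | add α α' _ _ h h' =>
      convert! p.add_mem h h'
      ext i; simp [toComplex]
    | neg α _ h =>
      convert! p.neg_mem h
      ext i; simp [toComplex]
  have hβ : β ∈ p := by
    have e : β = ∑ i, β i • toComplex (Pi.single i 1) := by
      ext i
      simp [toComplex, Pi.single_apply]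
    rw [e]
    exact Submodule.sum_mem _ fun i _ => p.smul_mem _ (h _)
  obtain ⟨w, hw⟩ := (Submodule.mem_span_range_iff_exists_fun ℂ).1 hβ
  refine ⟨w, fun i => ?_⟩
  rw [← hw]
  simp [toComplex, Matrix.col, mul_comm]

/-! ### Independence of the first column -/

variable {A : Matrix (Fin d) (Fin (n + 1)) ℤ} {β : Fin d → ℂ} {l : Fin d → ℂ}

theorem sum_mul_sum_eq (hl : ∀ j : Fin n, ∑ i, l i * (A i j.succ : ℂ) = 0)
    (hl0 : ∑ i, l i * (A i 0 : ℂ) = 1) (w : Fin (n + 1) → ℂ) :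
    ∑ i, l i * ∑ j, (A i j : ℂ) * w j = w 0 := by
  simp only [Finset.mul_sum, ← mul_assoc]
  rw [Finset.sum_comm]
  simp only [← Finset.sum_mul]
  simp [Fin.sum_univ_succ, hl, hl0]

/-- The linear form `l` isolates `θ_0` among the Euler operators. -/
theorem X_sub_C_mem_bIdeal (hl : ∀ j : Fin n, ∑ i, l i * (A i j.succ : ℂ) = 0)
    (hl0 : ∑ i, l i * (A i 0 : ℂ) = 1) :
    Polynomial.X - Polynomial.C (∑ i, l i * β i) ∈ bIdeal A β 0 := by
  have e : (X 0 - C (∑ i, l i * β i) : MvPolynomial (Fin (n + 1)) ℂ) =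
      ∑ i, C (l i) * (∑ j, (A i j : ℂ) • X j - C (β i)) := by
    simp only [mul_sub, Finset.sum_sub_distrib, map_sum, map_mul, Finset.mul_sum, smul_eq_C_mul]
    congr 1
    rw [Finset.sum_comm]
    simp only [← mul_assoc, ← map_mul, ← Finset.sum_mul, ← map_sum]
    rw [Fin.sum_univ_succ, hl0]
    simp only [hl, map_one, map_zero, zero_mul, Finset.sum_const_zero, one_mul, add_zero]
  have h := thetaHom_mem_hypergeometricIdeal A β
    (p := X 0 - C (∑ i, l i * β i)) (by
      rw [e]
      exact Ideal.sum_mem _ fun i _ => Ideal.mul_mem_left _ _ (Ideal.subset_span ⟨i, rfl⟩))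
  rw [mem_bIdeal]
  refine mem_hypergeometricAddV_of_mem_ideal ?_
  rw [map_sub, Weyl.thetaHom_X] at h
  rw [map_sub, Polynomial.aeval_X, Polynomial.aeval_C]
  rwa [← MvPolynomial.algebraMap_eq, AlgHom.commutes] at h

/-- If `a_0` is independent of the other columns, then `1 ∉ H_A(β) + V^1 D`: the indicator function
of the fiber over `β` is supported on a hyperplane `w_0 = ε`, which `V^1 D` moves. -/
theorem one_notMem_bIdeal (hA : AddSubgroup.closure (Set.range A.col) = ⊤)
    (hl : ∀ j : Fin n, ∑ i, l i * (A i j.succ : ℂ) = 0) (hl0 : ∑ i, l i * (A i 0 : ℂ) = 1) :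
    1 ∉ bIdeal A β 0 := by
  intro h
  rw [mem_bIdeal, map_one] at h
  obtain ⟨P, hP, Q, hQ, e⟩ := Submodule.mem_sup.1 h
  obtain ⟨w, hw⟩ := exists_sum_mul_eq hA β
  have hF : fiberIndicator A β ∈ Weyl.supportedAt 0 (∑ i, l i * β i) := by
    intro w hw
    refine Set.indicator_of_notMem (fun h => hw ?_) _
    rw [← sum_mul_sum_eq hl hl0 w]
    exact Finset.sum_congr rfl fun i _ => by rw [h i]
  have hw0 : w 0 = ∑ i, l i * β i := by
    rw [← sum_mul_sum_eq hl hl0 w]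
    exact Finset.sum_congr rfl fun i _ => by rw [hw i]
  have h1 : Weyl.rep (n + 1) (P + Q) (fiberIndicator A β) w = fiberIndicator A β w := by
    rw [e, map_one, Module.End.one_apply]
  rw [map_add, LinearMap.add_apply, Pi.add_apply, rep_fiberIndicator_eq_zero A β hP, Pi.zero_apply,
    zero_add, Weyl.rep_apply_eq_zero_of_mem_V hF hQ hw0, fiberIndicator,
    Set.indicator_of_mem (show w ∈ {w | ∀ i, ∑ j, (A i j : ℂ) * w j = β i} from hw)] at h1
  exact zero_ne_one h1

theorem IsHypergeometricBFunction.eq_X_sub_C {b : Polynomial ℂ}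
    (hb : IsHypergeometricBFunction A β 0 b) (hA : AddSubgroup.closure (Set.range A.col) = ⊤)
    (hl : ∀ j : Fin n, ∑ i, l i * (A i j.succ : ℂ) = 0) (hl0 : ∑ i, l i * (A i 0 : ℂ) = 1) :
    b = Polynomial.X - Polynomial.C (∑ i, l i * β i) := by
  obtain ⟨hm, hbI, -⟩ := isHypergeometricBFunction_iff.1 hb
  refine (Polynomial.eq_of_monic_of_dvd_of_natDegree_le hm (Polynomial.monic_X_sub_C _)
    (hb.dvd (X_sub_C_mem_bIdeal hl hl0)) ?_).symm
  rw [Polynomial.natDegree_X_sub_C, Nat.one_le_iff_ne_zero]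
  intro h0
  rw [hm.natDegree_eq_zero.1 h0] at hbI
  exact one_notMem_bIdeal hA hl hl0 hbI

theorem mem_degrees_toricPiece_iff {A : Matrix (Fin d) (Fin m) ℤ} {α : Fin d → ℤ} :
    α ∈ degrees (toricPiece A) ↔ ∃ u, monoDegree A u = α := by
  constructor
  · intro h
    by_contra! hc
    refine h ((Submodule.eq_bot_iff _).2 ?_)
    rintro _ ⟨p, hp, rfl⟩
    have hs := mem_span_mono_of_isWeightedHomogeneous hp
    have he : {u | monoDegree A u = α} = ∅ := Set.eq_empty_iff_forall_notMem.2 hc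
    rw [he, Set.image_empty, Submodule.span_empty, Submodule.mem_bot] at hs
    rw [hs, map_zero]
  · rintro ⟨u, rfl⟩ h
    exact mk_mono_ne_zero A u
      ((Submodule.eq_bot_iff _).1 h _ ⟨mono u, isWeightedHomogeneous_mono A u, rfl⟩)

/-- If `a_0` is independent of the other columns, then `qdeg(S_{A'})` is the span of these, and it
meets the line `β + ℂ a_0` in exactly one point. -/
theorem lineIntersection_quasiDegrees_toricPiece
    (hA : AddSubgroup.closure (Set.range A.col) = ⊤)
    (hl : ∀ j : Fin n, ∑ i, l i * (A i j.succ : ℂ) = 0) (hl0 : ∑ i, l i * (A i 0 : ℂ) = 1) :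
    lineIntersection (quasiDegrees (toricPiece (dropFirst A))) β (toComplex (A.col 0)) =
      {(∑ i, l i * β i) • toComplex (A.col 0)} := by
  refine Set.eq_singleton_iff_unique_mem.2 ⟨⟨⟨β - (∑ i, l i * β i) • toComplex (A.col 0),
    fun p hp => ?_, by abel⟩, _, rfl⟩, ?_⟩
  · obtain ⟨w, hw⟩ := exists_sum_mul_eq hA β
    have hw0 : ∑ i, l i * β i = w 0 := by
      rw [← sum_mul_sum_eq hl hl0 w]
      exact Finset.sum_congr rfl fun i _ => by rw [hw i]
    have hG : aeval (eulerTail A) p = 0 := by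
      have := mem_span_descProd_of_eval_eq_zero isUpperSet_empty (aeval (eulerTail A) p)
        fun u _ => by
          rw [eval_aeval_eulerTail]
          exact hp _ ⟨_, mem_degrees_toricPiece_iff.2 ⟨u, rfl⟩, rfl⟩
      simpa using this
    have e : (β - (∑ i, l i * β i) • toComplex (A.col 0)) =
        fun i => aeval (fun j => w j.succ) (eulerTail A i) := by
      ext i
      rw [hw0, Pi.sub_apply, ← hw i, Fin.sum_univ_succ]
      simp [eulerTail, toComplex, Matrix.col, mul_comm]
    rw [e, ← comp_aeval_apply, hG, map_zero]
  · rintro _ ⟨⟨q, hq, rfl⟩, c, hc⟩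
    have h0 : ∑ i, l i * q i = 0 := by
      have := hq (∑ i, l i • X i) (by
        rintro _ ⟨α, hα, rfl⟩
        obtain ⟨u, rfl⟩ := mem_degrees_toricPiece_iff.1 hα
        have := sum_mul_monoDegree A l u
        simp only [hl, zero_mul, Finset.sum_const_zero] at this
        simpa [toComplex] using this)
      simpa using this
    have h1 : ∑ i, l i * (-q + β) i = c := by
      rw [hc]
      simp [toComplex, Matrix.col, mul_left_comm _ c, ← Finset.mul_sum, hl0]
    rw [hc, ← h1]
    congr 1
    simp [mul_add, Finset.sum_add_distrib, h0]

end GKZ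

end

theorem mainTheorem3 {d n : ℕ} (A : Matrix (Fin d) (Fin (n + 1)) ℤ)
    (hA : AddSubgroup.closure (Set.range A.col) = ⊤) (β : Fin d → ℂ) :
    -- the `b`-function of `M_A(β)` along `x_0 = 0` exists and is unique
    (∃! b : Polynomial ℂ, GKZ.IsHypergeometricBFunction A β 0 b) ∧
    -- the sum defining `J_{A,0}` stabilizes
    (∃ k : ℕ, GKZ.jIdeal A = ⨆ i ∈ Set.Icc 1 k, GKZ.jLevel A i) ∧
    ∀ b : Polynomial ℂ, GKZ.IsHypergeometricBFunction A β 0 b →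
      -- the general bound
      (∀ k : ℕ, GKZ.jIdeal A = ⨆ i ∈ Set.Icc 1 k, GKZ.jLevel A i →
        ∀ ε : ℂ, b.IsRoot ε →
          ε • GKZ.toComplex (A.col 0) ∈
              GKZ.lineIntersection
                (GKZ.quasiDegrees (GKZ.quotientPiece (GKZ.dropFirst A) (GKZ.barJ A)))
                β (GKZ.toComplex (A.col 0)) ∨
            ∃ i < k, ε = (i : ℂ)) ∧
      -- the first extreme case
      (ringKrullDim (GKZ.S A) = ringKrullDim (GKZ.S (GKZ.dropFirst A)) + 1 →
        ∃ ε : ℂ, b = Polynomial.X - Polynomial.C ε ∧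
          GKZ.lineIntersection (GKZ.quasiDegrees (GKZ.toricPiece (GKZ.dropFirst A)))
            β (GKZ.toComplex (A.col 0)) = {ε • GKZ.toComplex (A.col 0)}) ∧
      -- the second extreme case
      ((∃ c : Fin n → ℝ, (∀ j, 0 ≤ c j) ∧
          ∀ i, (A i 0 : ℝ) = ∑ j, c j * (GKZ.dropFirst A i j : ℝ)) →
        ∃ k : ℕ,
          IsLeast {t : ℕ | 0 < t ∧
            t • A.col 0 ∈ AddSubmonoid.closure (Set.range (GKZ.dropFirst A).col)} k ∧
          ∀ ε : ℂ, b.IsRoot ε → ∃ i < k, ε = (i : ℂ)) := by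
  refine ⟨GKZ.existsUnique_isHypergeometricBFunction (GKZ.bIdeal_ne_bot A β),
    GKZ.exists_jIdeal_eq_iSup A, fun b hb =>
      ⟨fun k hk ε hε => GKZ.isRoot_mem_lineIntersection_or hb hk hε, fun hdim => ?_,
        fun ⟨c, hc, h⟩ => GKZ.exists_isLeast_and_roots hb hc h⟩⟩
  rcases GKZ.exists_relation_or_exists_form A Finset.univ with ⟨k, u, w, hk, -, h⟩ | ⟨l, hl, hl0⟩
  · obtain ⟨s, hs, hs'⟩ := GKZ.ringKrullDim_toricRing_eq hk h
    rw [hs, hs'] at hdim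
    have : s = s + 1 := by exact_mod_cast hdim
    lia
  · have hl' : ∀ j : Fin n, ∑ i, l i * (A i j.succ : ℂ) = 0 := fun j => hl j (Finset.mem_univ j)
    exact ⟨_, hb.eq_X_sub_C hA hl' hl0, GKZ.lineIntersection_quasiDegrees_toricPiece hA hl' hl0⟩
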